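/- Let $\mathbf{k}$ be a (nonzero) commutative unitary ring containing $\mathbb{Q}$, and let $X=\{x_i\mid i\ge 1\}$ be commuting variables. A weak composition is a finite (possibly empty) list of nonnegative integers; it is left weak if it is empty or its last component is positive. Let $\mathrm{LWC}$ be the set of left weak compositions. For a weak composition $\alpha=(\alpha_1,\dots,\alpha_k)$ and a vector $\beta=(\beta_1,\dots,\beta_k)$ of positive integers, let $$\phi\binom{\alpha}{\beta}=\sum_{1\le i_1<\cdots<i_k}x_{i_1}^{\alpha_1}\cdots x_{i_k}^{\alpha_k}\,e^{(i_1+t)\beta_1z}\cdots e^{(i_k+t)\beta_kz}\in\mathbb{Q}[[X]][t][z^{-1},z]],$$ where the coefficient of each monomial in $X$, a sum that is absolutely convergent for $t\ge 0$ and $\mathrm{Re}(z)<0$, is replaced by its Laurent expansion at $z=0$, whose coefficients are polynomials in $t$. Let $P$ be the projection of $\mathbb{Q}[[X]][t][z^{-1},z]]$ onto the polar part, $P\big(\sum_{n\ge N} a_nz^n\big)=\sum_{N\le n<0}a_nz^n$. Let $\phi_-$ and $\phi_+$ be the two components of the algebraic Birkhoff factorization $\phi=\phi_+\star\phi_-^{\star(-1)}$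 with respect to the deconcatenation coproduct, that is, $\phi_\pm(\emptyset)=1$ and, for $k\ge1$, $$\phi_-\binom{\alpha}{\beta}=-P(\Phi),\qquad \phi_+\binom{\alpha}{\beta}=(\mathrm{id}-P)(\Phi),\qquad \Phi=\phi\binom{\alpha}{\beta}+\sum_{i=1}^{k-1}\phi\binom{\alpha_1,\dots,\alpha_i}{\beta_1,\dots,\beta_i}\,\phi_-\binom{\alpha_{i+1},\dots,\alpha_k}{\beta_{i+1},\dots,\beta_k}.$$ Fix a positive integer $\delta$. The renormalized monomial quasisymmetric function of a weak composition $\alpha$ of length $k$ is $$M_\alpha:=\phi_+\binom{\alpha}{\delta,\dots,\delta}\Big|_{z=0}\in\mathbb{Q}[[X]][t],$$ regarded as an element of $\mathbf{k}[[X]][t]$; write $M_0:=M_{(0)}$. Let $\mathrm{RenQSym}\subseteq\mathbf{k}[[X]][t]$ be the $\mathbf{k}$-submodule spanned by the $M_\alpha$ for all weak compositions $\alpha$. Then, for every positive integer $\delta$, the family $M_0^nM_\alpha$, indexed by the pairs $(n,\alpha)$ with $n\in\mathbb{N}$ and $\alpha\in\mathrm{LWC}$, is a $\mathbf{k}$-basis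 of $\mathrm{RenQSym}$. -/

import Mathlib

open scoped Polynomial Topology

namespace RenQ

/-- A weak composition: a finite, possibly empty, list of nonnegative integers. -/
abbrev WeakComp : Type := List ℕ

/-- A weak composition is left weak if its last component is positive; the empty composition
is left weak. -/
def IsLeftWeak (α : WeakComp) : Prop := ∀ h : α ≠ [], 0 < α.getLast h

/-- The set `LWC` of left weak compositions. -/
abbrev LeftWeakComp : Type := {α : WeakComp // IsLeftWeak α}

/-- A directed weak bicomposition: a weak composition `α` (first entries) together with a vector
`β` of positive integers of the same length (second entries). -/
abbrev DirWeakBicomp : Type := List (ℕ × ℕ+)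

/-- The weak composition `α` in the constant direction `(δ, …, δ)`. -/
def constDir (δ : ℕ+) (α : WeakComp) : DirWeakBicomp := α.map fun a => (a, δ)

/-- The ring `R[[X]][t]`, where `X = {x_i | i ≥ 1}`. -/
abbrev PolySeries (R : Type*) [CommRing R] : Type _ := (MvPowerSeries ℕ+ R)[X]

/-- The exponent vector of the monomial `x_{i_1}^{α_1} ⋯ x_{i_k}^{α_k}`. -/
noncomputable def monomialExp (w : DirWeakBicomp) (i : Fin w.length ↪o ℕ+) : ℕ+ →₀ ℕ :=
  ∑ j, Finsupp.single (i j) (w.get j).1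

/-- The coefficient of the monomial `x^m` in the regularized sum
`∑_{i_1 < ⋯ < i_k} x_{i_1}^{α_1} ⋯ x_{i_k}^{α_k} e^{(i_1+t)β_1 z} ⋯ e^{(i_k+t)β_k z}`,
as a function of `t` and `z` (used for `t ≥ 0` and `Re z < 0`, where the sum converges
absolutely). -/
noncomputable def regCoeff (w : DirWeakBicomp) (m : ℕ+ →₀ ℕ) (t : ℝ) (z : ℂ) : ℂ :=
  ∑' i : {i : Fin w.length ↪o ℕ+ // monomialExp w i = m},
    ∏ j, Complex.exp ((((i.1 j : ℕ) : ℂ) + (t : ℂ)) * (((w.get j).2 : ℕ) : ℂ) * z)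

/-- For `f ∈ ℚ[[X]][t]`, the coefficient of `x^m`, a polynomial in `t`, evaluated at a real
number `t`. -/
noncomputable def evalCoeff (f : PolySeries ℚ) (m : ℕ+ →₀ ℕ) (t : ℝ) : ℂ :=
  f.sum fun s g => ((MvPowerSeries.coeff m g : ℚ) : ℂ) * (t : ℂ) ^ s

/-- The Laurent series `F ∈ ℚ[[X]][t][z⁻¹, z]]` is the expansion at `z = 0` of the regularized
sum: for each monomial `x^m` and each `t ≥ 0`, the coefficient of `x^m` in `F` converges to that
of the regularized sum, for all `z` close to `0` with `Re z < 0`. -/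
def IsExpansion (w : DirWeakBicomp) (F : LaurentSeries (PolySeries ℚ)) : Prop :=
  ∀ (m : ℕ+ →₀ ℕ) (t : ℝ), 0 ≤ t → ∀ᶠ z in 𝓝[{z : ℂ | z.re < 0}] (0 : ℂ),
    HasSum (fun n : ℤ => evalCoeff (F.coeff n) m t * z ^ n) (regCoeff w m t z)

open Classical in
/-- The regularization map `φ` on directed weak bicompositions: the Laurent expansion of the
regularized sum. -/
noncomputable def phi (w : DirWeakBicomp) : LaurentSeries (PolySeries ℚ) :=
  if h : ∃ F, IsExpansion w F then h.choose else 0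

/-- The Rota-Baxter operator `P`: the projection onto the polar part
`∑_{n ≥ N} a_n z^n ↦ ∑_{N ≤ n < 0} a_n z^n`. -/
noncomputable def polarPart (F : LaurentSeries (PolySeries ℚ)) : LaurentSeries (PolySeries ℚ) :=
  HahnSeries.truncLT (0 : ℤ) F

/-- The component `φ₋` of the algebraic Birkhoff factorization `φ = φ₊ ⋆ φ₋^{⋆(-1)}` with respect
to the deconcatenation coproduct. -/
noncomputable def phiMinus (w : DirWeakBicomp) : LaurentSeries (PolySeries ℚ) :=
  if w = [] then 1
  else -polarPart (phi w +
    ∑ i : Fin (w.length - 1), phi (w.take (i + 1)) * phiMinus (w.drop (i + 1)))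
termination_by w.length
decreasing_by
  have := i.2
  simp only [List.length_drop]
  omega

/-- The component `φ₊` (the renormalization of `φ`). -/
noncomputable def phiPlus (w : DirWeakBicomp) : LaurentSeries (PolySeries ℚ) :=
  if w = [] then 1
  else
    let F := phi w +
      ∑ i : Fin (w.length - 1), phi (w.take (i + 1)) * phiMinus (w.drop (i + 1))
    F - polarPart F

/-- The directional quasisymmetric function `Z(α; β) = φ₊(α; β)|_{z = 0}`. -/
noncomputable def dirQSym (w : DirWeakBicomp) : PolySeries ℚ := (phiPlus w).coeff 0

/-- The renormalized monomial quasisymmetric function `M_α = Z(α; δ, …, δ)`, regarded in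
`k[[X]][t]` for a ring `k` containing `ℚ`. -/
noncomputable def renM (k : Type*) [CommRing k] [Algebra ℚ k] (δ : ℕ+) (α : WeakComp) :
    PolySeries k :=
  Polynomial.map (MvPowerSeries.map (algebraMap ℚ k)) (dirQSym (constDir δ α))

/-- The `k`-module `RenQSym` of renormalized quasisymmetric functions: all `k`-linear
combinations of the `M_α`, where `α` runs over the weak compositions. -/
noncomputable def renQSym (k : Type*) [CommRing k] [Algebra ℚ k] (δ : ℕ+) :
    Submodule k (PolySeries k) :=
  Submodule.span k (Set.range (renM k δ))

end RenQ

/-! Write a weak composition as `γ 0^r` with `γ` left weak, and let `N = maxIdx m` be the largest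
index of a variable occurring in `x^m` (0 if there is none). If `γ` is nonempty, its last entry is
positive, so its last index must equal `N`. Hence only finitely many index sequences of `γ`
contribute to `x^m`, and the trailing zeros run freely beyond `N`. The coefficient of `x^m` in `φ(γ
0^r)` is therefore that of `φ(γ)`, which is regular at `z = 0`, times `φ(0^r)` with `t` replaced by
`t + N` (`lkappa_phi_append_zeros`).

The factorization respects this product. The difference of `φ(0^r)` at `t` and at `t + 1` consists
of the sequences starting with 1. It follows that `φ₋(0^r)` is invariant under `t ↦ t + 1`
(`shift_zeroMinus`), and that `φ₋(γ 0^r) = 0` for nonempty `γ` (`phiMinus_append_zeros`). At `z = 0`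
the coefficient of `x^m` in `M_{γ 0^r}` is `c_γ(m) p_r(t + N)`. Here `c_γ(m)` counts index
sequences, `p_0 = 1`, and `p_{r+1}(t) - p_{r+1}(t+1) = p_r(t+1)` (`kappa_dirQSym`). So `p_r` has
degree exactly `r`, `M_γ` does not involve `t`, and `M_0 = p_1` is linear in `t`.

The rest is algebra. Taylor expansion of `p_r(t + N)` writes `M_{γ 0^r}` as a sum of terms `t^i`
times `M_γ` with its coefficients multiplied by a polynomial in `N`. Multiplication by `N` preserves
the span of the `M_γ`, by a quasi-shuffle identity (`maxIdx_mul_indexCount`), and the top term is a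
unit times `t^r M_γ`. So RenQSym consists of the combinations of the `M_γ` with coefficients in
`k[t]`. These `M_γ` are independent over `k[t]` (`countCombination_injective`), and the powers of
the linear polynomial `p_1` form a basis of `k[t]`. -/

namespace RenQ

/-! ### Laurent series: coefficientwise maps, regular series, formal exponentials. -/

section LaurentMap

variable {R S A : Type*} [CommRing R] [CommRing S] [CommRing A]

/-- The coefficientwise image of a Laurent series under an additive map. -/
noncomputable def lmapAdd (f : R →+ S) : LaurentSeries R →+ LaurentSeries S where
  toFun F := HahnSeries.map F f
  map_zero' := by ext; simp
  map_add' F G := by ext; simp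

@[simp] lemma coeff_lmapAdd (f : R →+ S) (F : LaurentSeries R) (n : ℤ) :
    (lmapAdd f F).coeff n = f (F.coeff n) := rfl

lemma support_lmapAdd_subset (f : R →+ S) (F : LaurentSeries R) :
    (lmapAdd f F).support ⊆ F.support := fun i hi hF => hi (by simp [hF])

/-- Extracting the coefficient of a monomial is not multiplicative, only linear over the polynomials
in `t`; hence a semilinear version of multiplicativity. -/
lemma lmapAdd_semilinear (f : R →+ S) (g : A →+* R) (h : A →+* S)
    (hf : ∀ a r, f (g a * r) = h a * f r) (G : LaurentSeries A) (F : LaurentSeries R) :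
    lmapAdd f (lmapAdd g.toAddMonoidHom G * F) =
      lmapAdd h.toAddMonoidHom G * lmapAdd f F := by
  ext n
  rw [coeff_lmapAdd, HahnSeries.coeff_mul_left' G.isPWO_support (support_lmapAdd_subset _ _)]
  rw [HahnSeries.coeff_mul]
  rw [map_sum]
  simp only [coeff_lmapAdd, RingHom.toAddMonoidHom_eq_coe, AddMonoidHom.coe_coe, hf]
  symm
  apply Finset.sum_subset
  · intro ij hij
    simp only [Finset.mem_antidiagonal] at hij ⊢
    exact ⟨support_lmapAdd_subset _ _ hij.1, support_lmapAdd_subset _ _ hij.2.1, hij.2.2⟩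
  · intro ij hij hij'
    simp only [Finset.mem_antidiagonal, not_and, HahnSeries.mem_support] at hij hij'
    by_contra hne
    refine hij' ?_ ?_ hij.2.2
    · exact fun h0 => hne (by rw [show h _ = 0 from h0, zero_mul])
    · exact fun h0 => hne (by rw [show f _ = 0 from h0, mul_zero])

/-- The coefficientwise image of a Laurent series under a ring homomorphism. -/
noncomputable def lmap (f : R →+* S) : LaurentSeries R →+* LaurentSeries S where
  toFun := lmapAdd f.toAddMonoidHom
  map_zero' := map_zero _
  map_add' := map_add _
  map_one' := by
    ext n
    simp only [coeff_lmapAdd, HahnSeries.coeff_one]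
    split_ifs <;> simp
  map_mul' F G := by
    have := lmapAdd_semilinear f.toAddMonoidHom (RingHom.id R) f (by simp) F G
    rw [← this]
    congr 2

@[simp] lemma coeff_lmap (f : R →+* S) (F : LaurentSeries R) (n : ℤ) :
    (lmap f F).coeff n = f (F.coeff n) := rfl

lemma lmap_lmap (f : R →+* S) (g : A →+* R) (F : LaurentSeries A) :
    lmap f (lmap g F) = lmap (f.comp g) F := rfl

lemma lmapAdd_lmap_mul (f : R →+ S) (g : A →+* R) (h : A →+* S)
    (hf : ∀ a r, f (g a * r) = h a * f r) (G : LaurentSeries A) (F : LaurentSeries R) :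
    lmapAdd f (lmap g G * F) = lmap h G * lmapAdd f F :=
  lmapAdd_semilinear f g h hf G F

lemma lmap_ofPowerSeries (f : R →+* S) (G : PowerSeries R) :
    lmap f (HahnSeries.ofPowerSeries ℤ R G) =
      HahnSeries.ofPowerSeries ℤ S (PowerSeries.map f G) := by
  ext n
  simp only [coeff_lmap, PowerSeries.coeff_coe]
  split_ifs <;> simp

/-- A Laurent series without polar part. -/
def IsRegular (F : LaurentSeries R) : Prop := ∀ n < 0, F.coeff n = 0

lemma IsRegular.eq_ofPowerSeries {F : LaurentSeries R} (hF : IsRegular F) :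
    F = HahnSeries.ofPowerSeries ℤ R (PowerSeries.mk fun n => F.coeff n) := by
  ext n
  rw [PowerSeries.coeff_coe]
  split_ifs with h
  · exact hF n h
  · rw [PowerSeries.coeff_mk, Int.natAbs_of_nonneg (by omega)]

lemma isRegular_ofPowerSeries (G : PowerSeries R) :
    IsRegular (HahnSeries.ofPowerSeries ℤ R G) := by
  intro n hn
  rw [PowerSeries.coeff_coe, if_pos hn]

lemma IsRegular.mul {F G : LaurentSeries R} (hF : IsRegular F) (hG : IsRegular G) :
    IsRegular (F * G) := by
  rw [hF.eq_ofPowerSeries, hG.eq_ofPowerSeries, ← map_mul]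
  exact isRegular_ofPowerSeries _

/-- Evaluation at `z = 0` is multiplicative as long as no poles are present. -/
lemma IsRegular.coeff_zero_mul {F G : LaurentSeries R} (hF : IsRegular F) (hG : IsRegular G) :
    (F * G).coeff 0 = F.coeff 0 * G.coeff 0 := by
  have h : (F * G).coeff 0 = PowerSeries.coeff 0
      ((PowerSeries.mk fun n => F.coeff n) * (PowerSeries.mk fun n => G.coeff n)) := by
    conv_lhs => rw [hF.eq_ofPowerSeries, hG.eq_ofPowerSeries, ← map_mul, PowerSeries.coeff_coe]
    simp
  rw [h, PowerSeries.coeff_zero_eq_constantCoeff, map_mul]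
  simp

lemma IsRegular.sum {ι : Type*} {s : Finset ι} {F : ι → LaurentSeries R}
    (hF : ∀ i ∈ s, IsRegular (F i)) : IsRegular (∑ i ∈ s, F i) := fun n hn => by
  rw [HahnSeries.coeff_sum]
  exact Finset.sum_eq_zero fun i hi => hF i hi n hn

lemma isRegular_one : IsRegular (1 : LaurentSeries R) := fun n hn => by
  simp [HahnSeries.coeff_one, hn.ne]

lemma IsRegular.lmap {F : LaurentSeries R} (hF : IsRegular F) (f : R →+* S) :
    IsRegular (lmap f F) := fun n hn => by simp [hF n hn]

/-- The formal exponential `e^{a z}` as a Laurent series in `z`. -/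
noncomputable def lexp [Algebra ℚ R] (a : R) : LaurentSeries R :=
  HahnSeries.ofPowerSeries ℤ R (PowerSeries.rescale a (PowerSeries.exp R))

lemma lexp_add [Algebra ℚ R] (a b : R) : lexp (a + b) = lexp a * lexp b := by
  rw [lexp, lexp, lexp, ← map_mul, PowerSeries.exp_mul_exp_eq_exp_add]

lemma lexp_zero [Algebra ℚ R] : lexp (0 : R) = 1 := by
  simp [lexp, PowerSeries.rescale_zero]

lemma isRegular_lexp [Algebra ℚ R] (a : R) : IsRegular (lexp a) := isRegular_ofPowerSeries _

lemma coeff_lexp_natCast [Algebra ℚ R] (a : R) (n : ℕ) :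
    (lexp a).coeff n = a ^ n * algebraMap ℚ R (1 / n.factorial) := by
  rw [lexp, HahnSeries.ofPowerSeries_apply_coeff]
  simp [PowerSeries.coeff_rescale, PowerSeries.coeff_exp]

lemma coeff_zero_lexp [Algebra ℚ R] (a : R) : (lexp a).coeff 0 = 1 := by
  simpa using coeff_lexp_natCast a 0

lemma lmap_lexp [Algebra ℚ R] [Algebra ℚ S] (f : R →+* S) (a : R) :
    lmap f (lexp a) = lexp (f a) := by
  rw [lexp, lexp, lmap_ofPowerSeries]
  congr 1
  ext n
  simp [PowerSeries.coeff_rescale, PowerSeries.coeff_exp]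

lemma lexp_ne_one (c : ℚ) (hc : c ≠ 0) : 1 - lexp c ≠ 0 := by
  intro h
  have := congrArg (fun F => HahnSeries.coeff F 1) h
  have h1 := coeff_lexp_natCast c 1
  simp only [Nat.cast_one] at h1
  simp [h1, HahnSeries.coeff_one, hc] at this

/-- The Laurent series of `e^{cz} / (1 - e^{cz})`. -/
noncomputable def geo (c : ℚ) : LaurentSeries ℚ := lexp c / (1 - lexp c)

lemma geo_mul (c : ℚ) (hc : c ≠ 0) : geo c * (1 - lexp c) = lexp c :=
  div_mul_cancel₀ _ (lexp_ne_one c hc)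

end LaurentMap
-- Convergent Laurent expansions in the left half-plane.
section Represents

/-- The Laurent series `F` converges to `f z` for all `z` close to `0` with `Re z < 0`. -/
def Represents (F : LaurentSeries ℂ) (f : ℂ → ℂ) : Prop :=
  ∀ᶠ z in 𝓝[{z : ℂ | z.re < 0}] (0 : ℂ), HasSum (fun n : ℤ => F.coeff n * z ^ n) (f z)

lemma eventually_re_neg : ∀ᶠ z in 𝓝[{z : ℂ | z.re < 0}] (0 : ℂ), z.re < 0 :=
  eventually_mem_nhdsWithin

lemma exists_coeff_eq_zero_of_lt (F : LaurentSeries ℂ) :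
    ∃ N : ℕ, ∀ n : ℤ, n < -N → F.coeff n = 0 := by
  refine ⟨F.order.natAbs, fun n hn => HahnSeries.coeff_eq_zero_of_lt_order ?_⟩
  omega

lemma hasSum_laurent_iff {F : LaurentSeries ℂ} {N : ℕ} (hN : ∀ n : ℤ, n < -N → F.coeff n = 0)
    {z : ℂ} (hz : z ≠ 0) (s : ℂ) :
    HasSum (fun n : ℤ => F.coeff n * z ^ n) s ↔
      HasSum (fun m : ℕ => F.coeff (m - N) * z ^ m) (z ^ N * s) := by
  have hinj : Function.Injective (fun m : ℕ => (m : ℤ) - N) := fun a b h => by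
    simpa using h
  rw [← hinj.hasSum_iff, ← hasSum_mul_left_iff (pow_ne_zero N hz)]
  · refine iff_of_eq (congrArg (fun g => HasSum g _) ?_)
    funext m
    simp only [Function.comp_apply]
    rw [zpow_sub₀ hz, zpow_natCast, zpow_natCast]
    field_simp
  · intro n hn
    rw [hN n, zero_mul]
    by_contra h
    exact hn ⟨(n + N).toNat, by simp; omega⟩

lemma eq_single_mul_ofPowerSeries {F : LaurentSeries ℂ} {N : ℕ}
    (hN : ∀ n : ℤ, n < -N → F.coeff n = 0) :
    F = HahnSeries.single (-N : ℤ) 1 *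
      HahnSeries.ofPowerSeries ℤ ℂ (PowerSeries.mk fun m => F.coeff (m - N)) := by
  ext n
  rw [HahnSeries.coeff_single_mul, one_mul, PowerSeries.coeff_coe]
  split_ifs with h
  · exact hN n (by omega)
  · rw [PowerSeries.coeff_mk]
    congr 1
    omega

/-- Clearing the poles by powers of `z` reduces this to the Cauchy product of absolutely convergent
power series. -/
lemma hasSum_laurent_mul {F G : LaurentSeries ℂ} {z a b : ℂ} (hz : z ≠ 0)
    (hF : HasSum (fun n : ℤ => F.coeff n * z ^ n) a)
    (hG : HasSum (fun n : ℤ => G.coeff n * z ^ n) b) :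
    HasSum (fun n : ℤ => (F * G).coeff n * z ^ n) (a * b) := by
  obtain ⟨N, hN⟩ := exists_coeff_eq_zero_of_lt F
  obtain ⟨M, hM⟩ := exists_coeff_eq_zero_of_lt G
  set p := PowerSeries.mk fun m => F.coeff (m - N) with hp
  set q := PowerSeries.mk fun m => G.coeff (m - M) with hq
  have hFG : F * G = HahnSeries.single (-(N + M : ℕ) : ℤ) 1 *
      HahnSeries.ofPowerSeries ℤ ℂ (p * q) := by
    conv_lhs => rw [eq_single_mul_ofPowerSeries hN, eq_single_mul_ofPowerSeries hM]
    rw [map_mul, mul_mul_mul_comm, HahnSeries.single_mul_single, one_mul]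
    congr 3
    push_cast
    ring
  have hcoeff : ∀ m : ℕ, (F * G).coeff (m - (N + M : ℕ)) = PowerSeries.coeff m (p * q) := by
    intro m
    rw [hFG, HahnSeries.coeff_single_mul, one_mul, PowerSeries.coeff_coe, if_neg (by omega), sub_neg_eq_add,
      sub_add_cancel, Int.natAbs_natCast]
  have hNM : ∀ n : ℤ, n < -(N + M : ℕ) → (F * G).coeff n = 0 := by
    intro n hn
    rw [hFG, HahnSeries.coeff_single_mul, one_mul, PowerSeries.coeff_coe, if_pos (by omega)]
  rw [hasSum_laurent_iff hN hz] at hF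
  rw [hasSum_laurent_iff hM hz] at hG
  rw [hasSum_laurent_iff hNM hz]
  have h1 := hF.summable.norm
  have h2 := hG.summable.norm
  have hs := (summable_norm_sum_mul_antidiagonal_of_summable_norm h1 h2).of_norm.hasSum
  rw [← tsum_mul_tsum_eq_tsum_sum_antidiagonal_of_summable_norm h1 h2, hF.tsum_eq,
    hG.tsum_eq] at hs
  have hfun : (fun m : ℕ => (F * G).coeff (m - (N + M : ℕ)) * z ^ m) = fun n : ℕ =>
      ∑ kl ∈ Finset.HasAntidiagonal.antidiagonal n,
        F.coeff (kl.1 - N) * z ^ kl.1 * (G.coeff (kl.2 - M) * z ^ kl.2) := by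
    funext m
    rw [hcoeff, PowerSeries.coeff_mul, Finset.sum_mul]
    refine Finset.sum_congr rfl fun ij hij => ?_
    rw [← Finset.HasAntidiagonal.mem_antidiagonal.mp hij, hp, hq, PowerSeries.coeff_mk, PowerSeries.coeff_mk]
    ring
  rw [hfun, show z ^ (N + M) * (a * b) = z ^ N * a * (z ^ M * b) by ring]
  exact hs

lemma Represents.mul {F G : LaurentSeries ℂ} {f g : ℂ → ℂ} (hF : Represents F f)
    (hG : Represents G g) : Represents (F * G) (fun z => f z * g z) := by
  filter_upwards [hF, hG, eventually_re_neg] with z h1 h2 h3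
  exact hasSum_laurent_mul (fun h => by simp [h] at h3) h1 h2

lemma Represents.sub {F G : LaurentSeries ℂ} {f g : ℂ → ℂ} (hF : Represents F f)
    (hG : Represents G g) : Represents (F - G) (fun z => f z - g z) := by
  filter_upwards [hF, hG] with z h1 h2
  simpa [sub_mul] using h1.sub h2

lemma Represents.sum {ι : Type*} {s : Finset ι} {F : ι → LaurentSeries ℂ} {f : ι → ℂ → ℂ}
    (hF : ∀ i ∈ s, Represents (F i) (f i)) :
    Represents (∑ i ∈ s, F i) (fun z => ∑ i ∈ s, f i z) := by
  have h := (Filter.eventually_all_finset s).mpr hF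
  filter_upwards [h] with z hz
  simpa [HahnSeries.coeff_sum, Finset.sum_mul] using hasSum_sum hz

lemma Represents.congr {F : LaurentSeries ℂ} {f g : ℂ → ℂ} (hF : Represents F f)
    (h : ∀ z : ℂ, z.re < 0 → f z = g z) : Represents F g := by
  filter_upwards [hF, eventually_re_neg] with z h1 h2
  rwa [← h z h2]

lemma represents_ofPowerSeries {p : PowerSeries ℂ} {f : ℂ → ℂ}
    (h : ∀ᶠ z in 𝓝 (0 : ℂ), HasSum (fun n : ℕ => PowerSeries.coeff n p * z ^ n) (f z)) :
    Represents (HahnSeries.ofPowerSeries ℤ ℂ p) f := by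
  filter_upwards [eventually_nhdsWithin_of_eventually_nhds h, eventually_re_neg] with z h1 h2
  rw [hasSum_laurent_iff (N := 0) (fun n hn => ?_) (fun h => by simp [h] at h2)]
  · simpa using h1
  · exact isRegular_ofPowerSeries p n (by simpa using hn)

lemma represents_lexp (a : ℂ) : Represents (lexp a) (fun z => Complex.exp (a * z)) := by
  refine represents_ofPowerSeries (Filter.Eventually.of_forall fun z => ?_)
  have := NormedSpace.expSeries_div_hasSum_exp (a * z)
  rw [← Complex.exp_eq_exp_ℂ] at this
  refine (iff_of_eq (congrArg (fun g => HasSum g _) (funext fun n => ?_))).mp this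
  simp [PowerSeries.coeff_rescale, PowerSeries.coeff_exp, mul_pow]
  ring

lemma represents_one : Represents 1 (fun _ => 1) := by
  simpa [lexp_zero] using represents_lexp 0

lemma represents_single (n : ℤ) : Represents (HahnSeries.single n 1) (fun z => z ^ n) := by
  refine Filter.Eventually.of_forall fun z => ?_
  convert hasSum_ite_eq n (z ^ n) using 2 with m
  by_cases h : m = n <;> simp [h]

instance leftNeBot : (𝓝[{z : ℂ | z.re < 0}] (0 : ℂ)).NeBot := by
  rw [← mem_closure_iff_nhdsWithin_neBot, Metric.mem_closure_iff]
  intro ε hε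
  refine ⟨((-(ε / 2) : ℝ) : ℂ), by simpa using hε, ?_⟩
  rw [dist_zero_left, Complex.norm_real, Real.norm_eq_abs, abs_neg, abs_of_pos (half_pos hε)]
  exact half_lt_self hε

/-- The identity theorem: after multiplication by `z ^ N`, convergence at one nonzero point gives a
positive radius, and the zeros in the left half-plane accumulate at 0. -/
lemma Represents.eq_zero {F : LaurentSeries ℂ} (hF : Represents F (fun _ => 0)) : F = 0 := by
  obtain ⟨N, hN⟩ := exists_coeff_eq_zero_of_lt F
  have h1 : ∀ᶠ z in 𝓝[{z : ℂ | z.re < 0}] (0 : ℂ), z ≠ 0 ∧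
      HasSum (fun m : ℕ => F.coeff (m - N) * z ^ m) 0 := by
    filter_upwards [hF, eventually_re_neg] with z h1 h2
    have hz : z ≠ 0 := fun h => by simp [h] at h2
    refine ⟨hz, ?_⟩
    rw [hasSum_laurent_iff hN hz] at h1
    simpa using h1
  set p := FormalMultilinearSeries.ofScalars ℂ (𝕜 := ℂ) (fun m : ℕ => F.coeff (m - N)) with hp
  have hpc : ∀ m, p.coeff m = F.coeff (m - N) := fun m =>
    FormalMultilinearSeries.coeff_ofScalars
  obtain ⟨z₀, hz₀, hs₀⟩ := h1.exists
  have hr : 0 < p.radius := by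
    refine lt_of_lt_of_le ?_ (p.le_radius_of_summable (r := ‖z₀‖₊) ?_)
    · simpa using hz₀
    · simpa [FormalMultilinearSeries.norm_apply_eq_norm_coef, hpc] using hs₀.summable.norm
  have hps := p.hasFPowerSeriesOnBall hr
  have hsum : ∀ᶠ z in 𝓝[{z : ℂ | z.re < 0}] (0 : ℂ), p.sum z = 0 := by
    filter_upwards [h1] with z hz
    rw [FormalMultilinearSeries.sum, ← hz.2.tsum_eq]
    refine tsum_congr fun m => ?_
    rw [FormalMultilinearSeries.apply_eq_pow_smul_coeff, hpc, smul_eq_mul, mul_comm]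
  have hfr : ∃ᶠ z in 𝓝[≠] (0 : ℂ), p.sum z = 0 := by
    refine Filter.Frequently.filter_mono hsum.frequently (nhdsWithin_mono _ ?_)
    intro z hz h
    rw [Set.mem_singleton_iff] at h
    simp [h] at hz
  have hz := hps.analyticAt.frequently_zero_iff_eventually_zero.mp hfr
  have hp0 : p = 0 := (hps.hasFPowerSeriesAt.congr hz).eq_zero
  ext n
  by_cases hn : n < -N
  · exact hN n hn
  · have := hpc (n + N).toNat
    rw [hp0] at this
    rw [show n = ((n + N).toNat : ℤ) - N by omega, ← this]
    simp [FormalMultilinearSeries.coeff]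

lemma Represents.unique {F G : LaurentSeries ℂ} {f : ℂ → ℂ} (hF : Represents F f)
    (hG : Represents G f) : F = G :=
  sub_eq_zero.mp (Represents.eq_zero ((hF.sub hG).congr fun _ _ => sub_self _))

lemma exists_represents_of_meromorphicAt {f : ℂ → ℂ} (hf : MeromorphicAt f 0) :
    ∃ F, Represents F f := by
  obtain ⟨n, p, hp⟩ := hf
  rw [hasFPowerSeriesAt_iff] at hp
  have h := represents_ofPowerSeries (p := PowerSeries.mk p.coeff)
    (f := fun z => (0 + z - 0) ^ n • f (0 + z)) (by
      filter_upwards [hp] with z hz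
      refine (iff_of_eq (congrArg (fun g => HasSum g _) (funext fun m => ?_))).mp hz
      rw [PowerSeries.coeff_mk, smul_eq_mul, mul_comm])
  refine ⟨_, ((represents_single (-n)).mul h).congr fun z hz => ?_⟩
  have : z ≠ 0 := fun h => by simp [h] at hz
  simp only [zero_add, sub_zero, smul_eq_mul]
  rw [← mul_assoc, zpow_neg, zpow_natCast, inv_mul_cancel₀ (pow_ne_zero n this), one_mul]

lemma norm_exp_mul_lt_one_of_re_neg {c : ℝ} (hc : 0 < c) {z : ℂ} (hz : z.re < 0) :
    ‖Complex.exp (c * z)‖ < 1 := by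
  rw [Complex.norm_exp, Real.exp_lt_one_iff]
  simpa using mul_neg_of_pos_of_neg hc hz

/-- The function is meromorphic, so it has some expansion `F`. Both `F` and `geo` solve `Y * (1 -
lexp c) = lexp c`, whose solution in the field of Laurent series is unique. -/
lemma represents_geo (c : ℕ+) :
    Represents (lmap (algebraMap ℚ ℂ) (geo (c : ℕ)))
      (fun z => Complex.exp ((c : ℕ) * z) / (1 - Complex.exp ((c : ℕ) * z))) := by
  have hc : ((c : ℕ) : ℚ) ≠ 0 := by exact_mod_cast c.pos.ne'
  obtain ⟨F, hF⟩ := exists_represents_of_meromorphicAt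
    (f := fun z => Complex.exp ((c : ℕ) * z) / (1 - Complex.exp ((c : ℕ) * z))) (by fun_prop)
  have h1 := (hF.mul (represents_one.sub (represents_lexp (c : ℕ)))).congr
    (g := fun z => Complex.exp ((c : ℕ) * z)) (fun z hz => by
      refine div_mul_cancel₀ _ (sub_ne_zero.mpr fun h => ?_)
      have := norm_exp_mul_lt_one_of_re_neg (c := (c : ℕ)) (by exact_mod_cast c.pos) hz
      rw [Complex.ofReal_natCast, ← h, norm_one] at this
      exact lt_irrefl _ this)
  have h2 := h1.unique (represents_lexp (c : ℕ))
  have h3 := congrArg (lmap (algebraMap ℚ ℂ)) (geo_mul _ hc)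
  rw [map_mul, map_sub, map_one, lmap_lexp, map_natCast] at h3
  have h4 : 1 - lexp ((c : ℕ) : ℂ) ≠ 0 := by
    rw [← map_natCast (algebraMap ℚ ℂ), ← lmap_lexp, ← map_one (lmap (algebraMap ℚ ℂ)), ← map_sub]
    exact (map_ne_zero _).mpr (lexp_ne_one _ hc)
  rw [mul_right_cancel₀ h4 (h3.trans h2.symm)]
  exact hF

end Represents
-- Index sequences, their weights, and summation over a free last index.
section Embeddings

variable {k : ℕ}

/-- The restriction of a strictly increasing sequence to all but its last member. -/
def initEmb (e : Fin (k + 1) ↪o ℕ+) : Fin k ↪o ℕ+ :=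
  Fin.castSuccOrderEmb.trans e

@[simp] lemma initEmb_apply (e : Fin (k + 1) ↪o ℕ+) (j : Fin k) :
    initEmb e j = e j.castSucc := rfl

/-- The extension of a strictly increasing sequence by one larger member. -/
def snocEmb (e : Fin k ↪o ℕ+) (n : ℕ+) (h : ∀ j, e j < n) : Fin (k + 1) ↪o ℕ+ :=
  OrderEmbedding.ofStrictMono (Fin.snoc (α := fun _ => ℕ+) e n) (by
    intro i j hij
    induction i using Fin.lastCases with
    | last => exact absurd hij (not_lt.mpr (Fin.le_last j))
    | cast i =>
      induction j using Fin.lastCases with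
      | last => simpa using h i
      | cast j => simpa using hij)

@[simp] lemma snocEmb_castSucc (e : Fin k ↪o ℕ+) (n : ℕ+) (h : ∀ j, e j < n) (j : Fin k) :
    snocEmb e n h j.castSucc = e j :=
  Fin.snoc_castSucc (α := fun _ => ℕ+) _ _ _

@[simp] lemma snocEmb_last (e : Fin k ↪o ℕ+) (n : ℕ+) (h : ∀ j, e j < n) :
    snocEmb e n h (Fin.last k) = n :=
  Fin.snoc_last (α := fun _ => ℕ+) _ _

lemma embedding_ext_castSucc {e e' : Fin (k + 1) ↪o ℕ+}
    (h : ∀ j : Fin k, e j.castSucc = e' j.castSucc) (hl : e (Fin.last k) = e' (Fin.last k)) :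
    e = e' := by
  ext j
  induction j using Fin.lastCases with
  | last => rw [hl]
  | cast j => rw [h]

lemma snocEmb_initEmb (e : Fin (k + 1) ↪o ℕ+) (n : ℕ+) (h : ∀ j, initEmb e j < n)
    (hn : n = e (Fin.last k)) : snocEmb (initEmb e) n h = e :=
  embedding_ext_castSucc (by simp) (by simp [hn])

/-- The exponent vector of `x_{e_1}^{a_1} ⋯ x_{e_k}^{a_k}`. -/
noncomputable def expVec (a : Fin k → ℕ) (e : Fin k ↪o ℕ+) : ℕ+ →₀ ℕ :=
  ∑ j, Finsupp.single (e j) (a j)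

lemma expVec_succ (a : Fin (k + 1) → ℕ) (e : Fin (k + 1) ↪o ℕ+) :
    expVec a e = expVec (Fin.init a) (initEmb e) +
      Finsupp.single (e (Fin.last k)) (a (Fin.last k)) := by
  rw [expVec, Fin.sum_univ_castSucc]
  rfl

lemma initEmb_snocEmb (e : Fin k ↪o ℕ+) (n : ℕ+) (h : ∀ j, e j < n) :
    initEmb (snocEmb e n h) = e := by
  ext j
  simp

/-- The sequences of indices contributing to the coefficient of `x^m`. -/
abbrev Idx (a : Fin k → ℕ) (m : ℕ+ →₀ ℕ) : Type := {e : Fin k ↪o ℕ+ // expVec a e = m}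

/-- The exponential weight of a sequence of indices. -/
noncomputable def weight (b : Fin k → ℕ+) (t : ℝ) (z : ℂ) (e : Fin k ↪o ℕ+) : ℂ :=
  ∏ j, Complex.exp ((((e j : ℕ) : ℂ) + (t : ℂ)) * ((b j : ℕ) : ℂ) * z)

lemma weight_succ (b : Fin (k + 1) → ℕ+) (t : ℝ) (z : ℂ) (e : Fin (k + 1) ↪o ℕ+) :
    weight b t z e = weight (Fin.init b) t z (initEmb e) *
      Complex.exp ((((e (Fin.last k) : ℕ) : ℂ) + (t : ℂ)) * ((b (Fin.last k) : ℕ) : ℂ) * z) := by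
  rw [weight, Fin.prod_univ_castSucc]
  rfl

lemma regCoeff_eq_tsum (w : DirWeakBicomp) (a : Fin k → ℕ) (b : Fin k → ℕ+) (hk : w.length = k)
    (h : ∀ j : Fin k, w.get (j.cast hk.symm) = (a j, b j)) (m : ℕ+ →₀ ℕ) (t : ℝ) (z : ℂ) :
    regCoeff w m t z = ∑' e : Idx a m, weight b t z e.1 := by
  subst hk
  obtain rfl : a = fun j => (w.get j).1 := funext fun j => (congrArg Prod.fst (h j)).symm
  obtain rfl : b = fun j => (w.get j).2 := funext fun j => (congrArg Prod.snd (h j)).symm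
  rfl

/-- Append a free index, given by its distance to the last index. -/
noncomputable def appendFree (a : Fin (k + 2) → ℕ) (ha : a (Fin.last (k + 1)) = 0)
    (m : ℕ+ →₀ ℕ) (p : Idx (Fin.init a) m × ℕ) : Idx a m :=
  ⟨snocEmb p.1.1 (p.1.1 (Fin.last k) + p.2.succPNat) (fun j =>
    lt_of_le_of_lt (p.1.1.monotone (Fin.le_last j)) (PNat.lt_add_right _ _)), by
    rw [expVec_succ, initEmb_snocEmb, ha, Finsupp.single_zero, add_zero, p.1.2]⟩

lemma appendFree_bijective (a : Fin (k + 2) → ℕ) (ha : a (Fin.last (k + 1)) = 0)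
    (m : ℕ+ →₀ ℕ) : Function.Bijective (appendFree a ha m) := by
  constructor
  · rintro ⟨⟨e, he⟩, g⟩ ⟨⟨e', he'⟩, g'⟩ h
    have h0 := Subtype.ext_iff.mp h
    have h1 : e = e' := by
      have := congrArg initEmb h0
      simpa [appendFree, initEmb_snocEmb] using this
    subst h1
    have h2 := DFunLike.congr_fun h0 (Fin.last (k + 1))
    simp only [appendFree, snocEmb_last, add_right_inj] at h2
    rw [Nat.succPNat_injective h2]
  · rintro ⟨e, he⟩
    have hlt : e (Fin.last k).castSucc < e (Fin.last (k + 1)) :=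
      e.strictMono (Fin.castSucc_lt_last _)
    -- The gap between the last two indices is at least 1, and `appendFree` adds the successor of
    -- its parameter; hence the subtraction of 1.
    refine ⟨⟨⟨initEmb e, ?_⟩, (e (Fin.last (k + 1)) - e (Fin.last k).castSucc : ℕ) - 1⟩, ?_⟩
    · rw [expVec_succ, ha, Finsupp.single_zero, add_zero] at he
      exact he
    · refine Subtype.ext (snocEmb_initEmb e _ (fun j => ?_) ?_)
      · exact lt_of_le_of_lt ((initEmb e).monotone (Fin.le_last j)) (PNat.lt_add_right _ _)
      rw [← PNat.coe_inj]
      have : (e (Fin.last k).castSucc : ℕ) < e (Fin.last (k + 1)) := hlt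
      simp only [initEmb_apply, PNat.add_coe, Nat.succPNat_coe]
      omega

lemma hasSum_geometric_succ {r : ℂ} (hr : ‖r‖ < 1) :
    HasSum (fun g : ℕ => r ^ (g + 1)) (r / (1 - r)) := by
  have := (hasSum_geometric_of_norm_lt_one hr).mul_left r
  rw [div_eq_mul_inv]
  simpa [pow_succ'] using this

lemma norm_exp_pnat_mul_lt_one (c : ℕ+) {z : ℂ} (hz : z.re < 0) :
    ‖Complex.exp ((c : ℕ) * z)‖ < 1 := by
  have := norm_exp_mul_lt_one_of_re_neg (c := (c : ℕ)) (by exact_mod_cast c.pos) hz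
  simpa using this

/-- The weights obtained by merging the last two. -/
def mergeLast (b : Fin (k + 2) → ℕ+) : Fin (k + 1) → ℕ+ :=
  Fin.snoc (α := fun _ => ℕ+) (Fin.init (Fin.init b))
    (b (Fin.last k).castSucc + b (Fin.last (k + 1)))

lemma weight_appendFree (a : Fin (k + 2) → ℕ) (ha : a (Fin.last (k + 1)) = 0)
    (m : ℕ+ →₀ ℕ) (b : Fin (k + 2) → ℕ+) (t : ℝ) (z : ℂ) (p : Idx (Fin.init a) m × ℕ) :
    weight b t z (appendFree a ha m p).1 = weight (mergeLast b) t z p.1.1 *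
      Complex.exp ((b (Fin.last (k + 1)) : ℕ) * z) ^ (p.2 + 1) := by
  rw [weight_succ, weight_succ (mergeLast b), weight_succ (Fin.init b)]
  simp only [appendFree, initEmb_snocEmb, mergeLast, Fin.init_snoc, Fin.snoc_last, snocEmb_last]
  rw [← Complex.exp_nat_mul, mul_assoc (weight _ _ _ _), mul_assoc (weight _ _ _ _),
    ← Complex.exp_add, ← Complex.exp_add]
  congr 2
  simp only [Fin.init, PNat.add_coe, Nat.succPNat_coe]
  push_cast
  ring

lemma hasSum_mul_prod {ι κ : Type*} {f : ι → ℂ} {g : κ → ℂ} {s t : ℂ} (hf : HasSum f s)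
    (hg : HasSum g t) : HasSum (fun p : ι × κ => f p.1 * g p.2) (s * t) :=
  hf.mul hg (summable_mul_of_summable_norm (summable_norm_iff.mpr hf.summable)
    (summable_norm_iff.mpr hg.summable))

/-- A last index with exponent 0 is the previous index plus a gap `g ≥ 1`. The weight of the
previous index absorbs that of the last one, and the sum over `g` is geometric. -/
lemma hasSum_weight_append (a : Fin (k + 2) → ℕ) (ha : a (Fin.last (k + 1)) = 0)
    (m : ℕ+ →₀ ℕ) (b : Fin (k + 2) → ℕ+) (t : ℝ) {z : ℂ} (hz : z.re < 0) {s : ℂ}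
    (hs : HasSum (fun e : Idx (Fin.init a) m => weight (mergeLast b) t z e.1) s) :
    HasSum (fun e : Idx a m => weight b t z e.1)
      (s * (Complex.exp ((b (Fin.last (k + 1)) : ℕ) * z) /
        (1 - Complex.exp ((b (Fin.last (k + 1)) : ℕ) * z)))) := by
  have hg := hasSum_geometric_succ (norm_exp_pnat_mul_lt_one (b (Fin.last (k + 1))) hz)
  have h := hasSum_mul_prod hs hg
  rw [← (Equiv.ofBijective _ (appendFree_bijective a ha m)).hasSum_iff]
  have hfun : ((fun e : Idx a m => weight b t z e.1) ∘
      (Equiv.ofBijective _ (appendFree_bijective a ha m))) =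
      (fun p : Idx (Fin.init a) m × ℕ => weight (mergeLast b) t z p.1.1 *
        Complex.exp ((b (Fin.last (k + 1)) : ℕ) * z) ^ (p.2 + 1)) :=
    funext fun p => weight_appendFree a ha m b t z p
  rw [hfun]
  exact h

/-- The largest index of a variable occurring in `x^m`, or `0`. -/
def maxIdx (m : ℕ+ →₀ ℕ) : ℕ := m.support.sup fun i => (i : ℕ)

lemma expVec_apply (a : Fin k → ℕ) (e : Fin k ↪o ℕ+) (j : Fin k) : expVec a e (e j) = a j := by
  rw [expVec, Finsupp.finsetSum_apply, Finset.sum_eq_single j]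
  · simp
  · intro i _ hij
    exact Finsupp.single_eq_of_ne (fun h => hij (e.injective h).symm)
  · simp

lemma expVec_apply_of_notMem (a : Fin k → ℕ) (e : Fin k ↪o ℕ+) {i : ℕ+} (h : i ∉ Set.range e) :
    expVec a e i = 0 := by
  rw [expVec, Finsupp.finsetSum_apply]
  exact Finset.sum_eq_zero fun j _ => Finsupp.single_eq_of_ne (fun hi => h ⟨j, hi.symm⟩)

lemma maxIdx_expVec (a : Fin (k + 1) → ℕ) (ha : 0 < a (Fin.last k)) (e : Fin (k + 1) ↪o ℕ+) :
    maxIdx (expVec a e) = e (Fin.last k) := by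
  apply le_antisymm
  · refine Finset.sup_le fun i hi => ?_
    by_contra hlt
    refine (Finsupp.mem_support_iff.mp hi) (expVec_apply_of_notMem a e ?_)
    rintro ⟨j, rfl⟩
    exact hlt (e.monotone (Fin.le_last j))
  · refine Finset.le_sup (f := fun i : ℕ+ => (i : ℕ)) ?_
    rw [Finsupp.mem_support_iff, expVec_apply]
    exact ha.ne'

lemma Idx.apply_last {a : Fin (k + 1) → ℕ} (ha : 0 < a (Fin.last k)) {m : ℕ+ →₀ ℕ}
    (e : Idx a m) : (e.1 (Fin.last k) : ℕ) = maxIdx m := by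
  rw [← maxIdx_expVec a ha e.1, e.2]

lemma finite_idx_of_bounded (a : Fin k → ℕ) (m : ℕ+ →₀ ℕ) (N : ℕ)
    (h : ∀ e : Idx a m, ∀ j, (e.1 j : ℕ) ≤ N) : Finite (Idx a m) := by
  refine Finite.of_injective
    (fun e : Idx a m => fun j => (⟨e.1 j, Nat.lt_succ_of_le (h e j)⟩ : Fin (N + 1))) ?_
  intro e e' hee
  refine Subtype.ext (RelEmbedding.ext fun j => ?_)
  have := congrFun hee j
  simpa using this

/-- A positive last exponent pins the last index to `maxIdx m`, which bounds all the others. -/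
lemma finite_idx (a : Fin (k + 1) → ℕ) (ha : 0 < a (Fin.last k)) (m : ℕ+ →₀ ℕ) :
    Finite (Idx a m) :=
  finite_idx_of_bounded a m (maxIdx m) fun e j => by
    rw [← e.apply_last ha]
    exact e.1.monotone (Fin.le_last j)

instance finite_idx_zero (a : Fin 0 → ℕ) (m : ℕ+ →₀ ℕ) : Finite (Idx a m) :=
  finite_idx_of_bounded a m 0 fun _ j => j.elim0

lemma weight_eq_exp (b : Fin k → ℕ+) (t : ℝ) (z : ℂ) (e : Fin k ↪o ℕ+) :
    weight b t z e = Complex.exp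
      ((((∑ j, (e j : ℕ) * (b j : ℕ) : ℕ) : ℂ) + ((∑ j, (b j : ℕ) : ℕ) : ℂ) * t) * z) := by
  rw [weight, ← Complex.exp_sum]
  congr 1
  push_cast
  rw [Finset.sum_mul, ← Finset.sum_add_distrib, Finset.sum_mul]
  exact Finset.sum_congr rfl fun j _ => by ring

end Embeddings
-- Coefficients of monomials in `X`.
section Coefficients

variable {R : Type*} [CommRing R]

/-- The underlying function of `kappa`. -/
noncomputable def kappaFun (m : ℕ+ →₀ ℕ) (f : PolySeries R) : R[X] :=
  ∑ s ∈ f.support, Polynomial.monomial s (MvPowerSeries.coeff m (f.coeff s))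

lemma coeff_kappaFun (m : ℕ+ →₀ ℕ) (f : PolySeries R) (s : ℕ) :
    (kappaFun m f).coeff s = MvPowerSeries.coeff m (f.coeff s) := by
  simp only [kappaFun, Polynomial.finsetSum_coeff, Polynomial.coeff_monomial,
      Finset.sum_ite_eq', Polynomial.mem_support_iff]
  split_ifs with h
  · rfl
  · rw [Polynomial.notMem_support_iff.mp h, map_zero]

/-- The coefficient of `x^m` of an element of `R[[X]][t]`, as a polynomial in `t`. -/
noncomputable def kappa (m : ℕ+ →₀ ℕ) : PolySeries R →+ R[X] where
  toFun := kappaFun m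
  map_zero' := by ext; rw [coeff_kappaFun]; simp
  map_add' f g := by
    ext s
    simp only [Polynomial.coeff_add, coeff_kappaFun, map_add]

lemma coeff_kappa (m : ℕ+ →₀ ℕ) (f : PolySeries R) (s : ℕ) :
    (kappa m f).coeff s = MvPowerSeries.coeff m (f.coeff s) := coeff_kappaFun m f s

lemma polySeries_ext {f g : PolySeries R} (h : ∀ m, kappa m f = kappa m g) : f = g := by
  ext s m
  rw [← coeff_kappa, h, coeff_kappa]

/-- The inclusion `R[t] → R[[X]][t]`. -/
noncomputable def constPoly : R[X] →+* PolySeries R := Polynomial.mapRingHom MvPowerSeries.C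

lemma kappa_constPoly_mul (m : ℕ+ →₀ ℕ) (p : R[X]) (f : PolySeries R) :
    kappa m (constPoly p * f) = p * kappa m f := by
  ext s
  rw [coeff_kappa, Polynomial.coeff_mul, Polynomial.coeff_mul, map_sum]
  refine Finset.sum_congr rfl fun ij _ => ?_
  rw [constPoly, Polynomial.coe_mapRingHom, Polynomial.coeff_map, MvPowerSeries.coeff_C_mul,
    coeff_kappa]

lemma kappa_one (m : ℕ+ →₀ ℕ) : kappa m (1 : PolySeries R) = if m = 0 then 1 else 0 := by
  classical
  ext s
  rw [coeff_kappa, Polynomial.coeff_one]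
  split_ifs <;> simp_all [Polynomial.coeff_one, MvPowerSeries.coeff_one]

/-- The coefficientwise version of `kappa` for Laurent series. -/
noncomputable abbrev lkappa (m : ℕ+ →₀ ℕ) : LaurentSeries (PolySeries R) →+ LaurentSeries R[X] :=
  lmapAdd (kappa m)

lemma lkappa_ext {F G : LaurentSeries (PolySeries R)} (h : ∀ m, lkappa m F = lkappa m G) :
    F = G := by
  ext1
  funext n
  refine polySeries_ext fun m => ?_
  exact congrArg (fun H => HahnSeries.coeff H n) (h m)

lemma lkappa_lmap_mul (m : ℕ+ →₀ ℕ) (G : LaurentSeries R[X]) (F : LaurentSeries (PolySeries R)) :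
    lkappa m (lmap constPoly G * F) = G * lkappa m F := by
  have := lmapAdd_lmap_mul (kappa m) constPoly (RingHom.id R[X])
    (fun p f => kappa_constPoly_mul m p f) G F
  exact this

lemma lkappa_one (m : ℕ+ →₀ ℕ) :
    lkappa m (1 : LaurentSeries (PolySeries R)) = if m = 0 then 1 else 0 := by
  ext1
  funext n
  rw [coeff_lmapAdd, HahnSeries.coeff_one]
  by_cases hn : n = 0
  · subst hn
    rw [if_pos rfl, kappa_one]
    split_ifs <;> simp
  · rw [if_neg hn, map_zero]
    split_ifs <;> simp [HahnSeries.coeff_one, hn]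

/-- Gluing needs uniformity in `m`: the degree bound `B n` makes each coefficient of `z^n` a
polynomial in `t` over power series, and regularity bounds the orders in `z` from below. -/
lemma exists_lkappa_eq (G : (ℕ+ →₀ ℕ) → LaurentSeries R[X]) (hG : ∀ m, IsRegular (G m))
    (B : ℤ → ℕ) (hB : ∀ m n, ((G m).coeff n).natDegree ≤ B n) :
    ∃ F : LaurentSeries (PolySeries R), ∀ m, lkappa m F = G m := by
  let d : ℤ → ℕ → MvPowerSeries ℕ+ R := fun n s m => ((G m).coeff n).coeff s
  let c : ℤ → PolySeries R := fun n => ∑ s ∈ Finset.range (B n + 1), Polynomial.monomial s (d n s)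
  have hc : ∀ n m, kappa m (c n) = (G m).coeff n := by
    intro n m
    ext s
    rw [coeff_kappa]
    simp only [c, Polynomial.finsetSum_coeff, Polynomial.coeff_monomial, Finset.sum_ite_eq',
      Finset.mem_range]
    split_ifs with h
    · rfl
    · rw [map_zero, Polynomial.coeff_eq_zero_of_natDegree_lt]
      have := hB m n
      omega
  have hsupp : BddBelow (Function.support c) := by
    refine ⟨0, fun n hn => ?_⟩
    by_contra hlt
    refine hn (polySeries_ext fun m => ?_)
    rw [hc, hG m n (not_le.mp hlt), map_zero]
  refine ⟨HahnSeries.ofSuppBddBelow c hsupp, fun m => ?_⟩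
  ext1
  funext n
  rw [coeff_lmapAdd]
  exact hc n m

end Coefficients

/-! ### Uniqueness of the expansion, and merging of a trailing zero. -/

section Expansion

/-- Evaluation of a rational polynomial at a real number. -/
noncomputable def evalAt (t : ℝ) : ℚ[X] →+* ℂ := Polynomial.eval₂RingHom (algebraMap ℚ ℂ) (t : ℂ)

lemma evalCoeff_eq (f : PolySeries ℚ) (m : ℕ+ →₀ ℕ) (t : ℝ) :
    evalCoeff f m t = evalAt t (kappa m f) := by
  change _ = Polynomial.eval₂ _ _
    (∑ s ∈ f.support, Polynomial.monomial s (MvPowerSeries.coeff m (f.coeff s)))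
  rw [Polynomial.eval₂_finsetSum]
  simp only [Polynomial.eval₂_monomial]
  rfl

lemma isExpansion_iff (w : DirWeakBicomp) (F : LaurentSeries (PolySeries ℚ)) :
    IsExpansion w F ↔ ∀ (m : ℕ+ →₀ ℕ) (t : ℝ), 0 ≤ t →
      Represents (lmap (evalAt t) (lkappa m F)) (regCoeff w m t) := by
  simp only [IsExpansion, Represents, evalCoeff_eq]
  rfl

lemma evalAt_ext {p q : ℚ[X]} (h : ∀ t : ℝ, 0 ≤ t → evalAt t p = evalAt t q) : p = q := by
  apply Polynomial.map_injective _ (algebraMap ℚ ℂ).injective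
  apply Polynomial.eq_of_infinite_eval_eq
  refine Set.Infinite.mono (s := Set.range (fun n : ℕ => (n : ℂ))) ?_
    (Set.infinite_range_of_injective Nat.cast_injective)
  rintro _ ⟨n, rfl⟩
  have := h n (Nat.cast_nonneg n)
  simpa [evalAt, Polynomial.eval_map] using this

lemma lmap_evalAt_ext {F G : LaurentSeries ℚ[X]}
    (h : ∀ t : ℝ, 0 ≤ t → lmap (evalAt t) F = lmap (evalAt t) G) : F = G := by
  ext1
  funext n
  exact evalAt_ext fun t ht => congrArg (fun H => HahnSeries.coeff H n) (h t ht)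

/-- Makes the choice in `phi` harmless. Restricting to `t ≥ 0` loses nothing, since a polynomial is
determined by its values at the natural numbers. -/
lemma IsExpansion.unique {w : DirWeakBicomp} {F G : LaurentSeries (PolySeries ℚ)}
    (hF : IsExpansion w F) (hG : IsExpansion w G) : F = G := by
  rw [isExpansion_iff] at hF hG
  exact lkappa_ext fun m => lmap_evalAt_ext fun t ht => (hF m t ht).unique (hG m t ht)

lemma IsExpansion.phi_eq {w : DirWeakBicomp} {F : LaurentSeries (PolySeries ℚ)}
    (hF : IsExpansion w F) : phi w = F := by
  have h : ∃ F, IsExpansion w F := ⟨F, hF⟩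
  rw [phi, dif_pos h]
  exact h.choose_spec.unique hF

/-- The list `w` has entries `(a_j, b_j)`. -/
def HasEntries (w : DirWeakBicomp) {k : ℕ} (a : Fin k → ℕ) (b : Fin k → ℕ+) : Prop :=
  ∃ hk : w.length = k, ∀ j : Fin k, w.get (j.cast hk.symm) = (a j, b j)

lemma hasEntries_get (w : DirWeakBicomp) :
    HasEntries w (fun j => (w.get j).1) (fun j => (w.get j).2) :=
  ⟨rfl, fun _ => rfl⟩

lemma HasEntries.concat {w : DirWeakBicomp} {k : ℕ} {a : Fin k → ℕ} {b : Fin k → ℕ+}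
    (h : HasEntries w a b) (x : ℕ × ℕ+) :
    HasEntries (w ++ [x]) (Fin.snoc (α := fun _ => ℕ) a x.1)
      (Fin.snoc (α := fun _ => ℕ+) b x.2) := by
  obtain ⟨rfl, h⟩ := h
  refine ⟨by simp, fun j => ?_⟩
  induction j using Fin.lastCases with
  | last => simp
  | cast j =>
    rw [Fin.snoc_castSucc (α := fun _ => ℕ), Fin.snoc_castSucc (α := fun _ => ℕ+), ← h j]
    simp

lemma regCoeff_eq {w : DirWeakBicomp} {k : ℕ} {a : Fin k → ℕ} {b : Fin k → ℕ+}
    (h : HasEntries w a b) (m : ℕ+ →₀ ℕ) (t : ℝ) (z : ℂ) :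
    regCoeff w m t z = ∑' e : Idx a m, weight b t z e.1 := by
  obtain ⟨hk, h⟩ := h
  exact regCoeff_eq_tsum w a b hk h m t z

/-- The regularized sums of `w` converge for `Re z < 0`. -/
def RegSummable (w : DirWeakBicomp) : Prop :=
  ∀ (m : ℕ+ →₀ ℕ) (t : ℝ) (z : ℂ), z.re < 0 →
    Summable (fun e : Idx (fun j => (w.get j).1) m => weight (fun j => (w.get j).2) t z e.1)

lemma HasEntries.regSummable_iff {w : DirWeakBicomp} {k : ℕ} {a : Fin k → ℕ} {b : Fin k → ℕ+}
    (h : HasEntries w a b) : RegSummable w ↔ ∀ (m : ℕ+ →₀ ℕ) (t : ℝ) (z : ℂ), z.re < 0 →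
      Summable (fun e : Idx a m => weight b t z e.1) := by
  obtain ⟨rfl, h⟩ := h
  obtain rfl : a = fun j => (w.get j).1 := funext fun j => (congrArg Prod.fst (h j)).symm
  obtain rfl : b = fun j => (w.get j).2 := funext fun j => (congrArg Prod.snd (h j)).symm
  rfl

/-- The inclusion of `ℚ((z))` into `ℚ[[X]][t]((z))`. -/
noncomputable abbrev ratLaurent : LaurentSeries ℚ →+* LaurentSeries (PolySeries ℚ) :=
  (lmap constPoly).comp (lmap Polynomial.C)

lemma mergeLast_snoc {k : ℕ} (β : Fin k → ℕ+) (b c : ℕ+) :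
    mergeLast (Fin.snoc (α := fun _ => ℕ+) (Fin.snoc (α := fun _ => ℕ+) β b : Fin (k + 1) → ℕ+) c)
      = (Fin.snoc (α := fun _ => ℕ+) β (b + c) : Fin (k + 1) → ℕ+) := by
  simp only [mergeLast, Fin.init_snoc (α := fun _ => ℕ+), Fin.snoc_castSucc (α := fun _ => ℕ+),
    Fin.snoc_last (α := fun _ => ℕ+)]

lemma hasSum_merge {u : DirWeakBicomp} {a : ℕ} {b c : ℕ+}
    (h : RegSummable (u ++ [(a, b + c)])) :
    RegSummable ((u ++ [(a, b)]) ++ [(0, c)]) ∧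
    ∀ (m : ℕ+ →₀ ℕ) (t : ℝ) (z : ℂ), z.re < 0 → regCoeff ((u ++ [(a, b)]) ++ [(0, c)]) m t z =
      Complex.exp ((c : ℕ) * z) / (1 - Complex.exp ((c : ℕ) * z)) *
        regCoeff (u ++ [(a, b + c)]) m t z := by
  have hw := ((hasEntries_get u).concat (a, b)).concat (0, c)
  have hw' := (hasEntries_get u).concat (a, b + c)
  rw [hw'.regSummable_iff] at h
  have key : ∀ (m : ℕ+ →₀ ℕ) (t : ℝ) (z : ℂ), z.re < 0 → HasSum _ _ := fun m t z hz => by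
    have h0 := (h m t z hz).hasSum
    have h1 := hasSum_weight_append (Fin.snoc (α := fun _ => ℕ) (Fin.snoc (α := fun _ => ℕ)
      (fun j => (u.get j).1) a : Fin (u.length + 1) → ℕ) 0)
      (Fin.snoc_last (α := fun _ => ℕ) _ _) m (Fin.snoc (α := fun _ => ℕ+)
      (Fin.snoc (α := fun _ => ℕ+) (fun j => (u.get j).2) b : Fin (u.length + 1) → ℕ+) c) t hz
      (s := regCoeff (u ++ [(a, b + c)]) m t z) (by
        rw [mergeLast_snoc, Fin.init_snoc (α := fun _ => ℕ), regCoeff_eq hw']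
        exact h0)
    exact h1
  refine ⟨hw.regSummable_iff.mpr fun m t z hz => (key m t z hz).summable, fun m t z hz => ?_⟩
  rw [regCoeff_eq hw, (key m t z hz).tsum_eq, Fin.snoc_last (α := fun _ => ℕ+), mul_comm]

/-- `F` is the expansion of a convergent regularized sum. -/
structure Expands (w : DirWeakBicomp) (F : LaurentSeries (PolySeries ℚ)) : Prop where
  summable : RegSummable w
  isExpansion : IsExpansion w F

lemma lkappa_ratLaurent_mul (m : ℕ+ →₀ ℕ) (t : ℝ) (G : LaurentSeries ℚ)
    (F : LaurentSeries (PolySeries ℚ)) : lmap (evalAt t) (lkappa m (ratLaurent G * F)) =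
      lmap (algebraMap ℚ ℂ) G * lmap (evalAt t) (lkappa m F) := by
  rw [RingHom.comp_apply, lkappa_lmap_mul, map_mul, lmap_lmap]
  congr 2
  ext q
  simp

lemma Expands.merge {u : DirWeakBicomp} {a : ℕ} {b c : ℕ+} {F : LaurentSeries (PolySeries ℚ)}
    (h : Expands (u ++ [(a, b + c)]) F) :
    Expands ((u ++ [(a, b)]) ++ [(0, c)]) (ratLaurent (geo (c : ℕ)) * F) := by
  obtain ⟨h1, h2⟩ := hasSum_merge h.summable
  refine ⟨h1, (isExpansion_iff _ _).mpr fun m t ht => ?_⟩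
  rw [lkappa_ratLaurent_mul]
  exact ((represents_geo c).mul ((isExpansion_iff _ _).mp h.isExpansion m t ht)).congr
    fun z hz => (h2 m t z hz).symm

end Expansion
-- Expansions given by finite sums of exponentials.
section FiniteSums

variable {w : DirWeakBicomp} {k : ℕ} {a : Fin k → ℕ} {b : Fin k → ℕ+}

/-- The formal exponent of the weight of a sequence of indices, a polynomial in `t`. -/
noncomputable def formalExponent (b : Fin k → ℕ+) (e : Fin k ↪o ℕ+) : ℚ[X] :=
  ((∑ j, (e j : ℕ) * (b j : ℕ) : ℕ) : ℚ[X]) + ((∑ j, (b j : ℕ) : ℕ) : ℚ[X]) * Polynomial.X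

lemma natDegree_formalExponent_le (b : Fin k → ℕ+) (e : Fin k ↪o ℕ+) :
    (formalExponent b e).natDegree ≤ 1 := by
  refine Polynomial.natDegree_add_le_of_degree_le ?_ ?_
  · rw [Polynomial.natDegree_natCast]
    exact zero_le_one
  · refine (Polynomial.natDegree_mul_le).trans ?_
    rw [Polynomial.natDegree_natCast, Polynomial.natDegree_X]

lemma evalAt_formalExponent (t : ℝ) (b : Fin k → ℕ+) (e : Fin k ↪o ℕ+) :
    evalAt t (formalExponent b e) =
      ((∑ j, (e j : ℕ) * (b j : ℕ) : ℕ) : ℂ) + ((∑ j, (b j : ℕ) : ℕ) : ℂ) * t := by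
  rw [formalExponent, map_add, map_mul, map_natCast, map_natCast]
  simp [evalAt]

lemma natDegree_coeff_lexp_le {p : ℚ[X]} (hp : p.natDegree ≤ 1) (n : ℤ) :
    ((lexp p).coeff n).natDegree ≤ n.toNat := by
  rcases lt_or_ge n 0 with h | h
  · rw [isRegular_lexp p n h]
    simp
  · obtain ⟨n, rfl⟩ := Int.eq_ofNat_of_zero_le h
    rw [coeff_lexp_natCast, Polynomial.algebraMap_eq, mul_comm]
    refine (Polynomial.natDegree_C_mul_le _ _).trans (Polynomial.natDegree_pow_le.trans ?_)
    simpa using Nat.mul_le_mul_left n hp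

/-- The expansion at `z = 0` of the finite sum over all sequences contributing to `x^m`. -/
noncomputable def finiteSum (a : Fin k → ℕ) (b : Fin k → ℕ+) (m : ℕ+ →₀ ℕ) :
    LaurentSeries ℚ[X] := ∑ᶠ e : Idx a m, lexp (formalExponent b e.1)

lemma isRegular_finiteSum (a : Fin k → ℕ) (b : Fin k → ℕ+) (m : ℕ+ →₀ ℕ) [Finite (Idx a m)] :
    IsRegular (finiteSum a b m) := by
  have := Fintype.ofFinite (Idx a m)
  rw [finiteSum, finsum_eq_sum_of_fintype]
  exact IsRegular.sum fun e _ => isRegular_lexp _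

lemma coeff_zero_finiteSum (a : Fin k → ℕ) (b : Fin k → ℕ+) (m : ℕ+ →₀ ℕ) [Finite (Idx a m)] :
    (finiteSum a b m).coeff 0 = (Nat.card (Idx a m) : ℚ[X]) := by
  have := Fintype.ofFinite (Idx a m)
  rw [finiteSum, finsum_eq_sum_of_fintype, HahnSeries.coeff_sum]
  simp [coeff_zero_lexp]

lemma represents_finiteSum (a : Fin k → ℕ) (b : Fin k → ℕ+) (m : ℕ+ →₀ ℕ) [Finite (Idx a m)]
    (t : ℝ) : Represents (lmap (evalAt t) (finiteSum a b m))
      (fun z => ∑' e : Idx a m, weight b t z e.1) := by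
  have := Fintype.ofFinite (Idx a m)
  simp only [finiteSum, finsum_eq_sum_of_fintype, tsum_fintype, map_sum]
  refine Represents.sum fun e _ => ?_
  rw [lmap_lexp, evalAt_formalExponent]
  exact (represents_lexp _).congr fun z _ => (weight_eq_exp b t z e.1).symm

lemma exists_expands_of_finite (hw : HasEntries w a b) (hfin : ∀ m, Finite (Idx a m)) :
    ∃ F, Expands w F ∧ ∀ m, lkappa m F = finiteSum a b m := by
  obtain ⟨F, hF⟩ := exists_lkappa_eq (finiteSum a b) (fun m => isRegular_finiteSum a b m)
    Int.toNat (fun m n => by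
      have := Fintype.ofFinite (Idx a m)
      rw [finiteSum, finsum_eq_sum_of_fintype, HahnSeries.coeff_sum]
      exact Polynomial.natDegree_sum_le_of_forall_le _ _ fun e _ =>
        natDegree_coeff_lexp_le (natDegree_formalExponent_le b e.1) n)
  refine ⟨F, ⟨hw.regSummable_iff.mpr fun m t z _ => Summable.of_finite, (isExpansion_iff _ _).mpr
    fun m t _ => ?_⟩, hF⟩
  rw [hF]
  exact (represents_finiteSum a b m t).congr fun z _ => (regCoeff_eq hw m t z).symm

/-- The last index is `maxIdx m` for every contributing sequence, so the correction does not depend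
on `e` and can be pulled out of the sum. -/
lemma formalExponent_update_last {a : Fin (k + 1) → ℕ} (ha : 0 < a (Fin.last k)) {m : ℕ+ →₀ ℕ}
    (b b' : Fin (k + 1) → ℕ+) (c : ℕ) (hinit : Fin.init b' = Fin.init b)
    (hlast : (b' (Fin.last k) : ℕ) = b (Fin.last k) + c) (e : Idx a m) :
    formalExponent b' e.1 = formalExponent b e.1 + (c : ℚ[X]) * ((maxIdx m : ℚ[X]) + Polynomial.X) := by
  have hi : ∀ j : Fin k, b' j.castSucc = b j.castSucc := fun j => congrFun hinit j
  rw [formalExponent, formalExponent, Fin.sum_univ_castSucc, Fin.sum_univ_castSucc,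
    Fin.sum_univ_castSucc, Fin.sum_univ_castSucc, hlast, ← e.apply_last ha]
  simp only [hi]
  push_cast
  ring

lemma finiteSum_update_last {a : Fin (k + 1) → ℕ} (ha : 0 < a (Fin.last k)) (m : ℕ+ →₀ ℕ)
    (b b' : Fin (k + 1) → ℕ+) (c : ℕ) (hinit : Fin.init b' = Fin.init b)
    (hlast : (b' (Fin.last k) : ℕ) = b (Fin.last k) + c) :
    finiteSum a b' m = finiteSum a b m * lexp ((c : ℚ[X]) * ((maxIdx m : ℚ[X]) + Polynomial.X)) := by
  have := finite_idx a ha m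
  have := Fintype.ofFinite (Idx a m)
  rw [finiteSum, finiteSum, finsum_eq_sum_of_fintype, finsum_eq_sum_of_fintype, Finset.sum_mul]
  refine Finset.sum_congr rfl fun e _ => ?_
  rw [formalExponent_update_last ha b b' c hinit hlast, lexp_add]

end FiniteSums

/-! ### Trailing zeros and compositions consisting of zeros. -/

section Zeros

/-- The index sequence of length one with the given member. -/
def singleEmb (n : ℕ) : Fin 1 ↪o ℕ+ :=
  snocEmb ⟨⟨Fin.elim0, fun i => i.elim0⟩, fun {i} => i.elim0⟩ n.succPNat (fun j => j.elim0)

lemma singleEmb_last (n : ℕ) : singleEmb n (Fin.last 0) = n.succPNat := snocEmb_last _ _ _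

lemma singleEmb_bijective : Function.Bijective singleEmb := by
  constructor
  · intro i j h
    have := DFunLike.congr_fun h (Fin.last 0)
    rw [singleEmb_last, singleEmb_last] at this
    exact Nat.succPNat_injective this
  · intro e
    refine ⟨(e (Fin.last 0)).natPred, embedding_ext_castSucc (fun j => j.elim0) ?_⟩
    rw [singleEmb_last, PNat.succPNat_natPred]

lemma hasSum_single_zero (c : ℕ+) (t : ℝ) {z : ℂ} (hz : z.re < 0) :
    HasSum (fun e : Fin 1 ↪o ℕ+ => weight (fun _ => c) t z e)
      (Complex.exp ((c : ℕ) * t * z) *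
        (Complex.exp ((c : ℕ) * z) / (1 - Complex.exp ((c : ℕ) * z)))) := by
  rw [← (Equiv.ofBijective _ singleEmb_bijective).hasSum_iff]
  have h := (hasSum_geometric_succ (norm_exp_pnat_mul_lt_one c hz)).mul_left
    (Complex.exp ((c : ℕ) * t * z))
  have hfun : ((fun e : Fin 1 ↪o ℕ+ => weight (fun _ => c) t z e) ∘
      (Equiv.ofBijective _ singleEmb_bijective)) = (fun g : ℕ => Complex.exp ((c : ℕ) * t * z) *
        Complex.exp ((c : ℕ) * z) ^ (g + 1)) := by
    funext g
    simp only [Function.comp_apply, Equiv.ofBijective_apply]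
    rw [weight_succ, singleEmb_last, ← Complex.exp_nat_mul, ← Complex.exp_add]
    rw [weight, Finset.univ_eq_empty, Finset.prod_empty, one_mul, Nat.succPNat_coe]
    congr 1
    push_cast
    ring
  rw [hfun]
  exact h

lemma expVec_zero {k : ℕ} (e : Fin k ↪o ℕ+) : expVec (fun _ => 0) e = 0 := by
  simp [expVec]

lemma expands_single_zero (c : ℕ+) :
    Expands [(0, c)] (lmap constPoly
      (lmap Polynomial.C (geo (c : ℕ)) * lexp (((c : ℕ) : ℚ[X]) * Polynomial.X))) := by
  have hw : HasEntries [(0, c)] (fun _ : Fin 1 => 0) (fun _ => c) :=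
    ⟨rfl, fun j => by fin_cases j; rfl⟩
  have hpos : ∀ (t : ℝ) (z : ℂ), z.re < 0 →
      HasSum (fun e : Idx (fun _ : Fin 1 => 0) 0 => weight (fun _ => c) t z e.1)
      (Complex.exp ((c : ℕ) * t * z) *
        (Complex.exp ((c : ℕ) * z) / (1 - Complex.exp ((c : ℕ) * z)))) := fun t z hz => by
    rw [← (Equiv.subtypeUnivEquiv (p := fun e : Fin 1 ↪o ℕ+ => expVec (fun _ => 0) e = 0)
      expVec_zero).symm.hasSum_iff]
    exact hasSum_single_zero c t hz
  have hempty : ∀ m : ℕ+ →₀ ℕ, m ≠ 0 → IsEmpty (Idx (fun _ : Fin 1 => 0) m) := fun m hm =>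
    ⟨fun e => hm (e.2.symm.trans (expVec_zero _))⟩
  refine ⟨hw.regSummable_iff.mpr fun m t z hz => ?_, (isExpansion_iff _ _).mpr fun m t _ => ?_⟩
  · by_cases hm : m = 0
    · subst hm
      exact (hpos t z hz).summable
    · have := hempty m hm
      exact summable_empty
  · have h := lkappa_lmap_mul m
      (lmap Polynomial.C (geo (c : ℕ)) * lexp (((c : ℕ) : ℚ[X]) * Polynomial.X)) 1
    rw [mul_one, lkappa_one] at h
    rw [h]
    by_cases hm : m = 0
    · subst hm
      rw [if_pos rfl, mul_one, map_mul, lmap_lmap, lmap_lexp]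
      have h1 : (evalAt t).comp Polynomial.C = algebraMap ℚ ℂ := by ext; simp
      have h2 : evalAt t (((c : ℕ) : ℚ[X]) * Polynomial.X) = (c : ℕ) * t := by
        rw [map_mul, map_natCast]
        simp [evalAt]
      rw [h1, h2]
      refine ((represents_geo c).mul (represents_lexp _)).congr fun z hz => ?_
      rw [regCoeff_eq hw, (hpos t z hz).tsum_eq, mul_comm]
    · have := hempty m hm
      rw [if_neg hm, mul_zero, map_zero]
      refine Filter.Eventually.of_forall fun z => ?_
      rw [regCoeff_eq hw, tsum_empty]
      simp

/-- The product of the series of `e^{jδz} / (1 - e^{jδz})` for `1 ≤ j ≤ m`. -/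
noncomputable def geoProd (δ : ℕ+) (m : ℕ) : LaurentSeries ℚ :=
  ∏ j ∈ Finset.range m, geo (((δ * j.succPNat : ℕ+) : ℕ) : ℚ)

/-- Zeros are merged from the right. The last one carries the accumulated weight `δ * (l + 1)`, and
each merge raises `l` by one, so the induction on `m` must keep `l` general. -/
lemma Expands.append_zeros_aux (δ : ℕ+) (u : DirWeakBicomp) (a m : ℕ) :
    ∀ (l : ℕ) (F : LaurentSeries (PolySeries ℚ)),
    Expands (u ++ [(a, δ * (m + l + 1).succPNat)]) F →
    Expands ((u ++ (a, δ) :: List.replicate m (0, δ)) ++ [(0, δ * l.succPNat)])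
      (ratLaurent (∏ j ∈ Finset.range (m + 1), geo (((δ * (l + j).succPNat : ℕ+) : ℕ) : ℚ)) * F) := by
  have hadd : ∀ l : ℕ, δ + δ * l.succPNat = δ * (l + 1).succPNat := fun l => by
    rw [← PNat.coe_inj]
    simp only [PNat.add_coe, PNat.mul_coe, Nat.succPNat_coe, Nat.succ_eq_add_one]
    ring
  induction m with
  | zero =>
    intro l F hF
    have := Expands.merge (b := δ) (c := δ * l.succPNat) (u := u) (a := a) (F := F) (by
      rw [hadd]
      simpa using hF)
    simpa using this
  | succ m ih =>
    intro l F hF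
    have h1 := ih (l + 1) F (by rwa [show m + (l + 1) + 1 = m + 1 + l + 1 by ring])
    rw [← hadd] at h1
    have h2 := h1.merge
    rw [← mul_assoc, ← map_mul] at h2
    have h3 : geo (((δ * l.succPNat : ℕ+) : ℕ) : ℚ) * ∏ j ∈ Finset.range (m + 1),
        geo (((δ * (l + 1 + j).succPNat : ℕ+) : ℕ) : ℚ) =
        ∏ j ∈ Finset.range (m + 1 + 1), geo (((δ * (l + j).succPNat : ℕ+) : ℕ) : ℚ) := by
      rw [Finset.prod_range_succ' _ (m + 1), mul_comm]
      congr 1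
      exact Finset.prod_congr rfl fun j _ => by rw [show l + 1 + j = l + (j + 1) by ring]
    rw [h3] at h2
    rwa [List.replicate_succ', ← List.cons_append, ← List.append_assoc]

lemma Expands.append_zeros {δ : ℕ+} {u : DirWeakBicomp} {a m : ℕ}
    {F : LaurentSeries (PolySeries ℚ)} (hF : Expands (u ++ [(a, δ * m.succPNat)]) F) :
    Expands (u ++ (a, δ) :: List.replicate m (0, δ)) (ratLaurent (geoProd δ m) * F) := by
  cases m with
  | zero =>
    have : δ * Nat.succPNat 0 = δ := mul_one δ
    rw [this] at hF
    simpa [geoProd] using hF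
  | succ m =>
    have h := Expands.append_zeros_aux δ u a m 0 F (by simpa using hF)
    have h0 : δ * Nat.succPNat 0 = δ := mul_one δ
    rw [h0] at h
    simp only [zero_add] at h
    rwa [List.replicate_succ', ← List.cons_append, ← List.append_assoc]

/-- The expansion of the regularized sum of a composition consisting of `m` zeros. -/
noncomputable def zeroSeries (δ : ℕ+) (m : ℕ) : LaurentSeries ℚ[X] :=
  lmap Polynomial.C (geoProd δ m) * lexp (((m * δ : ℕ) : ℚ[X]) * Polynomial.X)

lemma phi_nil : phi [] = 1 := by
  obtain ⟨F, hF, hF'⟩ := exists_expands_of_finite (hasEntries_get [])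
    (fun m => finite_idx_zero _ m)
  rw [hF.isExpansion.phi_eq]
  refine lkappa_ext fun m => ?_
  rw [hF', lkappa_one, finiteSum]
  split_ifs with h
  · subst h
    have hu : Unique (Idx (fun j : Fin ([] : DirWeakBicomp).length =>
        (([] : DirWeakBicomp).get j).1) 0) :=
      ⟨⟨⟨⟨⟨Fin.elim0, fun i => i.elim0⟩, fun {i} => i.elim0⟩, rfl⟩⟩,
        fun e => Subtype.ext (RelEmbedding.ext fun j => j.elim0)⟩
    rw [finsum_unique, ← lexp_zero]
    congr 1
    simp [formalExponent]
  · have : IsEmpty (Idx (fun j : Fin ([] : DirWeakBicomp).length =>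
        (([] : DirWeakBicomp).get j).1) m) := ⟨fun e => h e.2.symm⟩
    exact finsum_of_isEmpty _

lemma phi_zeros (δ : ℕ+) (m : ℕ) :
    phi (List.replicate m (0, δ)) = lmap constPoly (zeroSeries δ m) := by
  cases m with
  | zero => simp [phi_nil, zeroSeries, geoProd, lexp_zero]
  | succ m =>
    have h := Expands.append_zeros (u := []) (expands_single_zero (δ * m.succPNat))
    rw [List.nil_append] at h
    rw [List.replicate_succ, h.isExpansion.phi_eq, zeroSeries, RingHom.comp_apply, ← map_mul,
      ← mul_assoc, ← map_mul, geoProd, geoProd, Finset.prod_range_succ]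
    congr 3
    simp [mul_comm]

end Zeros

/-! ### The map `φ` on a left weak composition followed by zeros. -/

section LeftWeak

/-- The number of sequences of indices contributing to the coefficient of `x^m` in the
quasisymmetric function of a left weak composition. -/
noncomputable def indexCount (α : WeakComp) (m : ℕ+ →₀ ℕ) : ℕ := Nat.card (Idx α.get m)

/-- The shift `t ↦ t + n`. -/
noncomputable abbrev shift (n : ℕ) : ℚ[X] →+* ℚ[X] := (Polynomial.taylorAlgHom (n : ℚ)).toRingHom

lemma isLeftWeak_iff_get {α : WeakComp} :
    IsLeftWeak α ↔ ∀ h : 0 < α.length, 0 < α.get ⟨α.length - 1, by omega⟩ := by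
  simp only [IsLeftWeak, List.length_pos_iff, List.getLast_eq_getElem, List.get_eq_getElem]

lemma finite_idx_of_last_pos {k : ℕ} (a : Fin k → ℕ)
    (ha : ∀ h : 0 < k, 0 < a ⟨k - 1, by omega⟩) (m : ℕ+ →₀ ℕ) : Finite (Idx a m) := by
  cases k with
  | zero => exact finite_idx_zero a m
  | succ k => exact finite_idx a (ha k.succ_pos) m

lemma finite_idx_of_isLeftWeak {α : WeakComp} (hα : IsLeftWeak α) (m : ℕ+ →₀ ℕ) :
    Finite (Idx α.get m) :=
  finite_idx_of_last_pos _ (isLeftWeak_iff_get.mp hα) m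

lemma hasEntries_constDir (δ : ℕ+) (α : WeakComp) :
    HasEntries (constDir δ α) α.get (fun _ => δ) :=
  ⟨by simp [constDir], fun j => by simp [constDir]; rfl⟩

lemma lkappa_phi_of_isLeftWeak {α : WeakComp} (hα : IsLeftWeak α) (δ : ℕ+) (m : ℕ+ →₀ ℕ) :
    lkappa m (phi (constDir δ α)) = finiteSum α.get (fun _ => δ) m := by
  obtain ⟨F, hF, hF'⟩ := exists_expands_of_finite (hasEntries_constDir δ α)
    (fun m => finite_idx_of_isLeftWeak hα m)
  rw [hF.isExpansion.phi_eq, hF']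

lemma isRegular_lkappa_phi {α : WeakComp} (hα : IsLeftWeak α) (δ : ℕ+) (m : ℕ+ →₀ ℕ) :
    IsRegular (lkappa m (phi (constDir δ α))) := by
  have := finite_idx_of_isLeftWeak hα m
  rw [lkappa_phi_of_isLeftWeak hα]
  exact isRegular_finiteSum _ _ m

lemma coeff_zero_lkappa_phi {α : WeakComp} (hα : IsLeftWeak α) (δ : ℕ+) (m : ℕ+ →₀ ℕ) :
    (lkappa m (phi (constDir δ α))).coeff 0 = (indexCount α m : ℚ[X]) := by
  have := finite_idx_of_isLeftWeak hα m
  rw [lkappa_phi_of_isLeftWeak hα, coeff_zero_finiteSum, indexCount]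

lemma constDir_append (δ : ℕ+) (α α' : WeakComp) :
    constDir δ (α ++ α') = constDir δ α ++ constDir δ α' := List.map_append

lemma constDir_zeros (δ : ℕ+) (r : ℕ) :
    constDir δ (List.replicate r 0) = List.replicate r (0, δ) := List.map_replicate

lemma shift_zeroSeries (δ : ℕ+) (n r : ℕ) :
    lmap (shift n) (zeroSeries δ r) = lmap Polynomial.C (geoProd δ r) *
      lexp (((r * δ : ℕ) : ℚ[X]) * ((n : ℚ[X]) + Polynomial.X)) := by
  have h1 : (shift n).comp Polynomial.C = Polynomial.C := by
    ext
    simp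
  have h2 : shift n Polynomial.X = (n : ℚ[X]) + Polynomial.X := by
    simp [Polynomial.taylor_X, add_comm]
  rw [zeroSeries, map_mul, lmap_lmap, lmap_lexp, h1, map_mul, map_natCast, h2]

/-- Merging the zeros into the last positive entry produces `geoProd δ r` and raises its weight by
`r * δ`. Its index being `maxIdx m`, the extra exponential is that of `zeroSeries` at `t + maxIdx
m`. For empty `α` only `m = 0` contributes, with shift 0. -/
lemma lkappa_phi_append_zeros {α : WeakComp} (hα : IsLeftWeak α) (δ : ℕ+) (r : ℕ)
    (m : ℕ+ →₀ ℕ) : lkappa m (phi (constDir δ (α ++ List.replicate r 0))) =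
      lkappa m (phi (constDir δ α)) * lmap (shift (maxIdx m)) (zeroSeries δ r) := by
  rw [constDir_append, constDir_zeros]
  rcases List.eq_nil_or_concat α with rfl | ⟨v, a, rfl⟩
  · have h := lkappa_lmap_mul m (zeroSeries δ r) 1
    rw [mul_one] at h
    change lkappa m (phi (List.replicate r (0, δ))) = lkappa m (phi []) * _
    rw [phi_zeros, h, phi_nil, lkappa_one]
    split_ifs with hm
    · subst hm
      have : shift (maxIdx 0) = RingHom.id ℚ[X] := by
        ext <;> simp [maxIdx]
      rw [this, mul_comm]
      rfl
    · simp
  · have ha : 0 < a := by simpa using hα (by simp)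
    rw [List.concat_eq_append] at hα ⊢
    rw [constDir_append, List.append_assoc]
    have hE : ∀ c : ℕ+, HasEntries (constDir δ v ++ [(a, c)]) _ _ := fun c =>
      (hasEntries_constDir δ v).concat (a, c)
    have hl : 0 < (Fin.snoc (α := fun _ => ℕ) v.get a : Fin (v.length + 1) → ℕ)
        (Fin.last v.length) := by
      rwa [Fin.snoc_last (α := fun _ => ℕ)]
    obtain ⟨F, hF, hF'⟩ := exists_expands_of_finite (hE (δ * r.succPNat))
      (fun m => finite_idx _ hl m)
    obtain ⟨G, hG, hG'⟩ := exists_expands_of_finite (hE δ) (fun m => finite_idx _ hl m)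
    have h1 : constDir δ v ++ (constDir δ [a] ++ List.replicate r (0, δ)) =
        constDir δ v ++ (a, δ) :: List.replicate r (0, δ) := rfl
    have h2 : phi (constDir δ v ++ constDir δ [a]) = G := hG.isExpansion.phi_eq
    rw [h1, hF.append_zeros.isExpansion.phi_eq, h2, RingHom.comp_apply, lkappa_lmap_mul, hF', hG',
      shift_zeroSeries, finiteSum_update_last hl m
        (Fin.snoc (α := fun _ => ℕ+) (fun _ => δ) δ : Fin (v.length + 1) → ℕ+)
        (Fin.snoc (α := fun _ => ℕ+) (fun _ => δ) (δ * r.succPNat) : Fin (v.length + 1) → ℕ+)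
        (r * δ)]
    · ring
    · rw [Fin.init_snoc (α := fun _ => ℕ+), Fin.init_snoc (α := fun _ => ℕ+)]
    · rw [Fin.snoc_last (α := fun _ => ℕ+), Fin.snoc_last (α := fun _ => ℕ+), PNat.mul_coe,
        Nat.succPNat_coe]
      simp only [Nat.succ_eq_add_one]
      ring

end LeftWeak
-- Polar parts, and the Birkhoff factorization on compositions consisting of zeros.
section Polar

variable {R S : Type*} [CommRing R] [CommRing S]

/-- The projection onto the polar part. -/
noncomputable def polar : LaurentSeries R →+ LaurentSeries R where
  toFun F := HahnSeries.truncLT (0 : ℤ) F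
  map_zero' := map_zero _
  map_add' F G := HahnSeries.truncLT_add 0 F G

lemma coeff_polar (F : LaurentSeries R) (n : ℤ) :
    (polar F).coeff n = if n < 0 then F.coeff n else 0 := rfl

lemma lmap_polar (f : R →+* S) (F : LaurentSeries R) : lmap f (polar F) = polar (lmap f F) := by
  ext n
  rw [coeff_lmap, coeff_polar, coeff_polar, coeff_lmap]
  split_ifs <;> simp

lemma IsRegular.polar_eq_zero {F : LaurentSeries R} (hF : IsRegular F) : polar F = 0 := by
  ext n
  rw [coeff_polar]
  split_ifs with h
  · exact hF n h
  · rfl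

lemma isRegular_sub_polar (F : LaurentSeries R) : IsRegular (F - polar F) := fun n hn => by
  rw [HahnSeries.coeff_sub, coeff_polar, if_pos hn, sub_self]

end Polar

section ZeroFactorization

variable (δ : ℕ+)

/-- The polar component of the factorization on compositions consisting of zeros. -/
noncomputable def zeroMinus : ℕ → LaurentSeries ℚ[X]
  | 0 => 1
  | m + 1 => -polar (∑ j : Fin (m + 1), zeroSeries δ (m + 1 - j) * zeroMinus j)

lemma zeroMinus_zero : zeroMinus δ 0 = 1 := by rw [zeroMinus]

lemma zeroMinus_succ (m : ℕ) : zeroMinus δ (m + 1) =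
    -polar (∑ j ∈ Finset.range (m + 1), zeroSeries δ (m + 1 - j) * zeroMinus δ j) := by
  rw [zeroMinus, Finset.sum_range]

lemma zeroSeries_zero : zeroSeries δ 0 = 1 := by
  simp [zeroSeries, geoProd, lexp_zero]

/-- The regular component of the factorization on compositions consisting of zeros. -/
noncomputable def zeroPlus (m : ℕ) : LaurentSeries ℚ[X] :=
  ∑ j ∈ Finset.range (m + 1), zeroSeries δ (m - j) * zeroMinus δ j

lemma zeroPlus_zero : zeroPlus δ 0 = 1 := by
  simp [zeroPlus, zeroSeries_zero, zeroMinus_zero]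

lemma zeroPlus_succ (m : ℕ) : zeroPlus δ (m + 1) =
    (∑ j ∈ Finset.range (m + 1), zeroSeries δ (m + 1 - j) * zeroMinus δ j) +
      zeroMinus δ (m + 1) := by
  rw [zeroPlus, Finset.sum_range_succ, Nat.sub_self, zeroSeries_zero, one_mul]

lemma isRegular_zeroPlus (m : ℕ) : IsRegular (zeroPlus δ m) := by
  cases m with
  | zero => rw [zeroPlus_zero]; exact isRegular_one
  | succ m =>
    rw [zeroPlus_succ, zeroMinus_succ, ← sub_eq_add_neg]
    exact isRegular_sub_polar _

/-- Replacing `t` by `t + 1` amounts to starting the indices at 2. The difference collects the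
sequences with first index 1, whose remaining `m` indices start at 2. -/
lemma zeroSeries_succ_sub_shift (m : ℕ) :
    zeroSeries δ (m + 1) - lmap (shift 1) (zeroSeries δ (m + 1)) =
      lexp (((δ : ℕ) : ℚ[X]) * (1 + Polynomial.X)) * lmap (shift 1) (zeroSeries δ m) := by
  rw [shift_zeroSeries, shift_zeroSeries, zeroSeries, Nat.cast_one, geoProd,
    Finset.prod_range_succ, ← geoProd, map_mul]
  have hc : (((δ * m.succPNat : ℕ+) : ℕ) : ℚ) ≠ 0 := by
    exact_mod_cast (δ * m.succPNat).pos.ne'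
  have hg := congrArg (lmap Polynomial.C) (geo_mul _ hc)
  rw [map_mul, map_sub, map_one, lmap_lexp, map_natCast, PNat.mul_coe, Nat.succPNat_coe] at hg
  rw [PNat.mul_coe, Nat.succPNat_coe]
  have h1 : (((m + 1) * δ : ℕ) : ℚ[X]) * (1 + Polynomial.X) =
      ((δ * (m.succ) : ℕ) : ℚ[X]) + (((m + 1) * δ : ℕ) : ℚ[X]) * Polynomial.X := by
    push_cast
    ring
  have h2 : (((m + 1) * δ : ℕ) : ℚ[X]) * (1 + Polynomial.X) =
      ((δ : ℕ) : ℚ[X]) * (1 + Polynomial.X) + ((m * δ : ℕ) : ℚ[X]) * (1 + Polynomial.X) := by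
    push_cast
    ring
  have h3 := congrArg lexp (h1.symm.trans h2)
  rw [lexp_add, lexp_add] at h3
  rw [h1, lexp_add]
  linear_combination (lmap Polynomial.C (geoProd δ m) *
    lexp ((((m + 1) * δ : ℕ) : ℚ[X]) * Polynomial.X)) * hg + lmap Polynomial.C (geoProd δ m) * h3

/-- With the earlier `zeroMinus` shift invariant, the difference equation of `zeroSeries` passes to
the Birkhoff sums. Its right side is then regular, which forces invariance of the next polar part.
-/
lemma shift_zeroMinus_aux (m : ℕ) : lmap (shift 1) (zeroMinus δ m) = zeroMinus δ m ∧
    zeroPlus δ (m + 1) - lmap (shift 1) (zeroPlus δ (m + 1)) =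
      lexp (((δ : ℕ) : ℚ[X]) * (1 + Polynomial.X)) * lmap (shift 1) (zeroPlus δ m) := by
  induction m using Nat.strong_induction_on with
  | _ m ih =>
    have hdiff : ∀ n, (∀ j ≤ n, lmap (shift 1) (zeroMinus δ j) = zeroMinus δ j) →
        (∑ j ∈ Finset.range (n + 1), zeroSeries δ (n + 1 - j) * zeroMinus δ j) -
          lmap (shift 1) (∑ j ∈ Finset.range (n + 1), zeroSeries δ (n + 1 - j) * zeroMinus δ j) =
        lexp (((δ : ℕ) : ℚ[X]) * (1 + Polynomial.X)) * lmap (shift 1) (zeroPlus δ n) := by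
      intro n hn
      rw [zeroPlus, map_sum, map_sum, Finset.mul_sum, ← Finset.sum_sub_distrib]
      refine Finset.sum_congr rfl fun j hj => ?_
      have hjn : j ≤ n := Nat.lt_succ_iff.mp (Finset.mem_range.mp hj)
      rw [map_mul, map_mul, hn j hjn, ← sub_mul, ← mul_assoc,
        show n + 1 - j = (n - j) + 1 by omega, zeroSeries_succ_sub_shift]
    have hsucc : ∀ n, (∀ j ≤ n, lmap (shift 1) (zeroMinus δ j) = zeroMinus δ j) →
        lmap (shift 1) (zeroMinus δ (n + 1)) = zeroMinus δ (n + 1) := by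
      intro n hn
      -- The two polar parts differ by the polar part of the right side of `hdiff`, a product of
      -- regular series.
      rw [zeroMinus_succ, map_neg, neg_inj, lmap_polar, eq_comm, ← sub_eq_zero, ← map_sub,
        hdiff n hn]
      exact ((isRegular_lexp _).mul ((isRegular_zeroPlus δ n).lmap _)).polar_eq_zero
    have hm : lmap (shift 1) (zeroMinus δ m) = zeroMinus δ m := by
      cases m with
      | zero => rw [zeroMinus_zero, map_one]
      | succ n => exact hsucc n fun j hj => (ih j (by omega)).1
    have hle : ∀ j ≤ m, lmap (shift 1) (zeroMinus δ j) = zeroMinus δ j := fun j hj => by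
      rcases hj.lt_or_eq with h | rfl
      · exact (ih j h).1
      · exact hm
    refine ⟨hm, ?_⟩
    rw [zeroPlus_succ, map_add, hsucc m hle, add_sub_add_right_eq_sub, hdiff m hle]

lemma shift_succ (n : ℕ) : shift (n + 1) = (shift 1).comp (shift n) := by
  ext
  · simp
  · simp only [RingHom.comp_apply, AlgHom.toRingHom_eq_coe, RingHom.coe_coe,
      Polynomial.taylorAlgHom_apply, Polynomial.taylor_X, map_add, Polynomial.taylor_C,
      Nat.cast_add, Nat.cast_one]
    ring_nf

lemma shift_zeroMinus (n m : ℕ) : lmap (shift n) (zeroMinus δ m) = zeroMinus δ m := by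
  induction n with
  | zero =>
    have : shift 0 = RingHom.id ℚ[X] := by ext <;> simp
    rw [this]
    rfl
  | succ n ih => rw [shift_succ, ← lmap_lmap, ih, (shift_zeroMinus_aux δ m).1]

/-- The constant term in `z` of `zeroPlus`. -/
noncomputable def zeroConst (m : ℕ) : ℚ[X] := (zeroPlus δ m).coeff 0

lemma zeroConst_zero : zeroConst δ 0 = 1 := by
  rw [zeroConst, zeroPlus_zero, HahnSeries.coeff_one, if_pos rfl]

lemma zeroConst_succ_sub_shift (m : ℕ) :
    zeroConst δ (m + 1) - shift 1 (zeroConst δ (m + 1)) = shift 1 (zeroConst δ m) := by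
  have h := congrArg (fun F => HahnSeries.coeff F 0) (shift_zeroMinus_aux δ m).2
  simp only [HahnSeries.coeff_sub, coeff_lmap] at h
  rw [(isRegular_lexp _).coeff_zero_mul ((isRegular_zeroPlus δ m).lmap _), coeff_zero_lexp,
    one_mul] at h
  exact h

end ZeroFactorization

/-! ### The difference operator and exact degrees. -/

section PolynomialDifference

lemma coeff_taylor_one_eq (p : ℚ[X]) (d : ℕ) (hp : p.natDegree ≤ d + 1) :
    (Polynomial.taylor 1 p).coeff d = p.coeff d + (d + 1) * p.coeff (d + 1) := by
  rw [Polynomial.taylor_coeff, Polynomial.eval_eq_sum_range' (n := 2)]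
  · simp [Finset.sum_range_succ, Polynomial.hasseDeriv_coeff, add_comm]
  · rw [Polynomial.natDegree_hasseDeriv]
    omega

/-- In characteristic zero the difference operator lowers a positive degree by exactly one. -/
lemma natDegree_of_sub_taylor {p q : ℚ[X]} {m : ℕ} (h : p - Polynomial.taylor 1 p = q)
    (hq : q.natDegree ≤ m) (hqm : q.coeff m ≠ 0) :
    p.natDegree ≤ m + 1 ∧ p.coeff (m + 1) ≠ 0 := by
  have hdeg : p.natDegree ≤ m + 1 := by
    by_contra hlt
    -- Here `d > m`, so `q` has no term of degree `d`, while the difference has `-(d + 1)` times the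
    -- leading coefficient of `p` there.
    obtain ⟨d, hd⟩ : ∃ d, p.natDegree = d + 1 := ⟨p.natDegree - 1, by omega⟩
    have h1 := congrArg (fun r => Polynomial.coeff r d) h
    simp only [Polynomial.coeff_sub] at h1
    rw [coeff_taylor_one_eq p d hd.le, Polynomial.coeff_eq_zero_of_natDegree_lt (p := q)
      (by omega)] at h1
    have h2 : p.coeff (d + 1) ≠ 0 := by
      rw [← hd, Polynomial.coeff_natDegree, Polynomial.leadingCoeff_ne_zero]
      rintro rfl
      simp at hd
    have h3 : ((d : ℚ) + 1) * p.coeff (d + 1) = 0 := by linarith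
    exact (mul_ne_zero (by positivity) h2) h3
  refine ⟨hdeg, fun h0 => hqm ?_⟩
  rw [← h, Polynomial.coeff_sub, coeff_taylor_one_eq p m hdeg, h0]
  ring

lemma zeroConst_degree (δ : ℕ+) (m : ℕ) :
    (zeroConst δ m).natDegree ≤ m ∧ (zeroConst δ m).coeff m ≠ 0 := by
  induction m with
  | zero => simp [zeroConst_zero]
  | succ m ih =>
    have h := zeroConst_succ_sub_shift δ m
    have hs : ∀ p : ℚ[X], shift 1 p = Polynomial.taylor 1 p := fun p => by simp
    rw [hs, hs] at h
    refine natDegree_of_sub_taylor h (by simpa using ih.1) ?_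
    have : (Polynomial.taylor 1 (zeroConst δ m)).coeff m =
        (zeroConst δ m).coeff m + (m + 1) * (zeroConst δ m).coeff (m + 1) :=
      coeff_taylor_one_eq _ _ (by omega)
    rw [this, Polynomial.coeff_eq_zero_of_natDegree_lt (n := m + 1) (by omega), mul_zero, add_zero]
    exact ih.2

end PolynomialDifference

/-! ### The Birkhoff factorization on all weak compositions in direction `δ`. -/

section Birkhoff

/-- The sum to which the projections onto the polar and the regular part are applied. -/
noncomputable def birkhoffSum (w : DirWeakBicomp) : LaurentSeries (PolySeries ℚ) :=
  ∑ i ∈ Finset.range w.length, phi (w.take (i + 1)) * phiMinus (w.drop (i + 1))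

lemma phiMinus_nil : phiMinus [] = 1 := by rw [phiMinus, if_pos rfl]

lemma birkhoffSum_eq {w : DirWeakBicomp} (hw : w ≠ []) :
    phi w + ∑ i : Fin (w.length - 1), phi (w.take (i + 1)) * phiMinus (w.drop (i + 1)) =
      birkhoffSum w := by
  obtain ⟨n, hn⟩ : ∃ n, w.length = n + 1 :=
    ⟨w.length - 1, by have := List.length_pos_iff.mpr hw; omega⟩
  rw [birkhoffSum, hn, Finset.sum_range_succ, ← hn, List.take_length, List.drop_length,
    phiMinus_nil, mul_one, add_comm, Finset.sum_range, hn]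
  rfl

lemma phiMinus_eq {w : DirWeakBicomp} (hw : w ≠ []) : phiMinus w = -polar (birkhoffSum w) := by
  rw [phiMinus, if_neg hw, birkhoffSum_eq hw]
  rfl

lemma phiPlus_eq {w : DirWeakBicomp} (hw : w ≠ []) :
    phiPlus w = birkhoffSum w + phiMinus w := by
  rw [phiMinus_eq hw, phiPlus, if_neg hw, birkhoffSum_eq hw]
  exact sub_eq_add_neg (birkhoffSum w) (polar (birkhoffSum w))

variable (δ : ℕ+)

lemma birkhoffSum_zeros_of (m : ℕ) (h : ∀ j ≤ m, phiMinus (List.replicate j (0, δ)) =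
    lmap constPoly (zeroMinus δ j)) : birkhoffSum (List.replicate (m + 1) (0, δ)) =
      lmap constPoly
        (∑ j ∈ Finset.range (m + 1), zeroSeries δ (m + 1 - j) * zeroMinus δ j) := by
  rw [birkhoffSum, List.length_replicate, map_sum, ← Finset.sum_range_reflect]
  refine Finset.sum_congr rfl fun j hj => ?_
  have hjm : j ≤ m := Nat.lt_succ_iff.mp (Finset.mem_range.mp hj)
  rw [List.take_replicate, List.drop_replicate, phi_zeros, map_mul,
    show m + 1 - (m + 1 - 1 - j + 1) = j by omega, h j hjm,
    show min (m + 1 - 1 - j + 1) (m + 1) = m + 1 - j by omega]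

lemma phiMinus_zeros (m : ℕ) : phiMinus (List.replicate m (0, δ)) =
    lmap constPoly (zeroMinus δ m) := by
  induction m using Nat.strong_induction_on with
  | _ m ih =>
    cases m with
    | zero => rw [zeroMinus_zero, map_one]; exact phiMinus_nil
    | succ m =>
      rw [phiMinus_eq (by simp), birkhoffSum_zeros_of δ m fun j hj => ih j (by omega),
        zeroMinus_succ, map_neg, lmap_polar]

lemma phiPlus_zeros (m : ℕ) : phiPlus (List.replicate m (0, δ)) =
    lmap constPoly (zeroPlus δ m) := by
  cases m with
  | zero => rw [zeroPlus_zero, map_one, List.replicate_zero, phiPlus, if_pos rfl]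
  | succ m =>
    rw [phiPlus_eq (by simp), birkhoffSum_zeros_of δ m fun j _ => phiMinus_zeros δ j,
      phiMinus_zeros, zeroPlus_succ, map_add]

lemma IsLeftWeak.drop {α : WeakComp} (hα : IsLeftWeak α) (n : ℕ) : IsLeftWeak (α.drop n) := by
  intro h
  rw [List.getLast_drop]
  exact hα _

lemma constDir_take (α : WeakComp) (n : ℕ) : (constDir δ α).take n = constDir δ (α.take n) :=
  List.map_take.symm

lemma constDir_drop (α : WeakComp) (n : ℕ) : (constDir δ α).drop n = constDir δ (α.drop n) :=
  List.map_drop.symm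

/-- Only cuts after the whole of `α` survive, and each leaves zeros on the right. Shift invariance
of `zeroMinus` lets the shift be applied to the entire sum, which is `zeroPlus`. -/
lemma lkappa_birkhoffSum_of {α : WeakComp} (hα : IsLeftWeak α) (hne : α ≠ []) (r : ℕ)
    (h : ∀ i < α.length - 1, phiMinus (constDir δ (α.drop (i + 1) ++ List.replicate r 0)) = 0)
    (m : ℕ+ →₀ ℕ) : lkappa m (birkhoffSum (constDir δ (α ++ List.replicate r 0))) =
      lkappa m (phi (constDir δ α)) * lmap (shift (maxIdx m)) (zeroPlus δ r) := by
  obtain ⟨n, hn⟩ : ∃ n, α.length = n + 1 :=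
    ⟨α.length - 1, by have := List.length_pos_iff.mpr hne; omega⟩
  have hlen : (constDir δ (α ++ List.replicate r 0)).length = n + (r + 1) := by
    simp [constDir, hn]
    ring
  have hz : ∀ i ∈ Finset.range n, phi ((constDir δ (α ++ List.replicate r 0)).take (i + 1)) *
      phiMinus ((constDir δ (α ++ List.replicate r 0)).drop (i + 1)) = 0 := by
    intro i hi
    have hi' := Finset.mem_range.mp hi
    rw [constDir_drop, List.drop_append_of_le_length (by omega), h i (by omega), mul_zero]
  -- The first `n` cuts lie strictly inside `α`. In the other `r + 1`, after reflection, `j` is the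
  -- number of zeros to the right of the cut.
  rw [birkhoffSum, hlen, Finset.sum_range_add, Finset.sum_eq_zero hz, zero_add, map_sum,
    zeroPlus, map_sum, Finset.mul_sum, ← Finset.sum_range_reflect]
  refine Finset.sum_congr rfl fun j hj => ?_
  have hjr : j ≤ r := Nat.lt_succ_iff.mp (Finset.mem_range.mp hj)
  rw [constDir_take, constDir_drop, List.take_append, List.drop_append,
    List.take_of_length_le (by omega), List.drop_of_length_le (by omega), List.take_replicate,
    List.drop_replicate, List.nil_append, constDir_zeros,
    show r - (n + (r + 1 - 1 - j) + 1 - α.length) = j by omega,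
    show min (n + (r + 1 - 1 - j) + 1 - α.length) r = r - j by omega,
    phiMinus_zeros, mul_comm (phi _), lkappa_lmap_mul, lkappa_phi_append_zeros hα, map_mul,
    shift_zeroMinus]
  ring

lemma isRegular_of_lkappa {F : LaurentSeries (PolySeries ℚ)} (h : ∀ m, IsRegular (lkappa m F)) :
    IsRegular F := fun n hn => polySeries_ext fun m => by
  rw [map_zero]
  exact h m n hn

lemma isRegular_birkhoffSum_of {α : WeakComp} (hα : IsLeftWeak α) (hne : α ≠ []) (r : ℕ)
    (h : ∀ i < α.length - 1, phiMinus (constDir δ (α.drop (i + 1) ++ List.replicate r 0)) = 0) :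
    IsRegular (birkhoffSum (constDir δ (α ++ List.replicate r 0))) :=
  isRegular_of_lkappa fun m => by
    rw [lkappa_birkhoffSum_of δ hα hne r h]
    exact (isRegular_lkappa_phi hα δ m).mul ((isRegular_zeroPlus δ r).lmap _)

lemma constDir_ne_nil {α : WeakComp} (h : α ≠ []) : constDir δ α ≠ [] := by
  simpa [constDir] using h

/-- Induction on the length of `α`: vanishing on the proper nonempty suffixes makes the Birkhoff sum
a product of regular series, so there is no polar part. -/
lemma phiMinus_append_zeros {α : WeakComp} (hα : IsLeftWeak α) (hne : α ≠ []) (r : ℕ) :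
    phiMinus (constDir δ (α ++ List.replicate r 0)) = 0 := by
  induction hl : α.length using Nat.strong_induction_on generalizing α with
  | _ l ih =>
    rw [phiMinus_eq (constDir_ne_nil δ (by simp [hne])),
      (isRegular_birkhoffSum_of δ hα hne r fun i hi => ?_).polar_eq_zero, neg_zero]
    refine ih (α.drop (i + 1)).length ?_ (hα.drop _) ?_ rfl
    · rw [List.length_drop]
      omega
    · rw [Ne, List.drop_eq_nil_iff]
      omega

lemma lkappa_phiPlus {α : WeakComp} (hα : IsLeftWeak α) (r : ℕ) (m : ℕ+ →₀ ℕ) :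
    lkappa m (phiPlus (constDir δ (α ++ List.replicate r 0))) =
      lkappa m (phi (constDir δ α)) * lmap (shift (maxIdx m)) (zeroPlus δ r) := by
  by_cases hne : α = []
  · subst hne
    have h := lkappa_lmap_mul m (zeroPlus δ r) 1
    rw [mul_one] at h
    rw [List.nil_append, constDir_zeros, phiPlus_zeros, h]
    change _ = lkappa m (phi []) * _
    rw [phi_nil, lkappa_one]
    split_ifs with hm
    · subst hm
      have : shift (maxIdx 0) = RingHom.id ℚ[X] := by
        ext <;> simp [maxIdx]
      rw [this, mul_comm]
      rfl
    · simp
  · have h : ∀ i < α.length - 1,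
        phiMinus (constDir δ (α.drop (i + 1) ++ List.replicate r 0)) = 0 := fun i hi =>
      phiMinus_append_zeros δ (hα.drop _) (by rw [Ne, List.drop_eq_nil_iff]; omega) r
    rw [phiPlus_eq (constDir_ne_nil δ (by simp [hne])),
      phiMinus_append_zeros δ hα hne, add_zero,
      lkappa_birkhoffSum_of δ hα hne r h]

theorem kappa_dirQSym {α : WeakComp} (hα : IsLeftWeak α) (r : ℕ) (m : ℕ+ →₀ ℕ) :
    kappa m (dirQSym (constDir δ (α ++ List.replicate r 0))) =
      (indexCount α m : ℚ[X]) * Polynomial.taylor (maxIdx m : ℚ) (zeroConst δ r) := by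
  have h := congrArg (fun F => HahnSeries.coeff F 0) (lkappa_phiPlus δ hα r m)
  beta_reduce at h
  rw [(isRegular_lkappa_phi hα δ m).coeff_zero_mul ((isRegular_zeroPlus δ r).lmap _),
    coeff_zero_lkappa_phi hα] at h
  exact h

end Birkhoff
-- Monomial quasisymmetric polynomials in finitely many variables, and a quasi-shuffle identity.
section BoundedSums

/-- The strictly increasing sequences with members at most `N`. -/
abbrev BoundedEmb (k N : ℕ) : Type := {e : Fin k ↪o ℕ+ // ∀ j, (e j : ℕ) ≤ N}

instance (k N : ℕ) : Finite (BoundedEmb k N) :=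
  Finite.of_injective
    (fun e : BoundedEmb k N => fun j => (⟨e.1 j, Nat.lt_succ_of_le (e.2 j)⟩ : Fin (N + 1)))
    fun e e' hee => Subtype.ext (RelEmbedding.ext fun j => by simpa using congrFun hee j)

noncomputable instance (k N : ℕ) : Fintype (BoundedEmb k N) := Fintype.ofFinite _

/-- The monomial quasisymmetric polynomial in `x_1, …, x_N`. -/
noncomputable def boundedSum {k : ℕ} (a : Fin k → ℕ) (N : ℕ) : MvPolynomial ℕ+ ℕ :=
  ∑ e : BoundedEmb k N, MvPolynomial.monomial (expVec a e.1) 1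

lemma lt_succPNat_of_le {i : ℕ+} {N : ℕ} (h : (i : ℕ) ≤ N) : i < N.succPNat :=
  Nat.lt_succ_of_le h

/-- A bounded sequence either satisfies the smaller bound or ends with the larger one. -/
noncomputable def boundedSplit (k N : ℕ) :
    BoundedEmb (k + 1) N ⊕ BoundedEmb k N → BoundedEmb (k + 1) (N + 1) :=
  Sum.elim (fun e => ⟨e.1, fun j => (e.2 j).trans N.le_succ⟩)
    (fun e => ⟨snocEmb e.1 N.succPNat (fun j => lt_succPNat_of_le (e.2 j)), fun j => by
      induction j using Fin.lastCases with
      | last => rw [snocEmb_last]; rfl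
      | cast j => rw [snocEmb_castSucc]; exact (e.2 j).trans N.le_succ⟩)

lemma boundedSplit_bijective (k N : ℕ) : Function.Bijective (boundedSplit k N) := by
  constructor
  · rintro (e | e) (e' | e') h
    · exact congrArg Sum.inl (Subtype.ext (congrArg (fun x => x.1) h))
    · have h1 := congrArg (fun x => (x.1 (Fin.last k) : ℕ)) h
      have h2 : (e.1 (Fin.last k) : ℕ) = N + 1 := by
        simpa [boundedSplit] using h1
      have := e.2 (Fin.last k)
      omega
    · have h1 := congrArg (fun x => (x.1 (Fin.last k) : ℕ)) h
      have h2 : N + 1 = (e'.1 (Fin.last k) : ℕ) := by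
        simpa [boundedSplit] using h1
      have := e'.2 (Fin.last k)
      omega
    · have h1 := congrArg (fun x => initEmb x.1) h
      simp only [boundedSplit, Sum.elim_inr, initEmb_snocEmb] at h1
      exact congrArg Sum.inr (Subtype.ext h1)
  · rintro ⟨e, he⟩
    by_cases h : (e (Fin.last k) : ℕ) ≤ N
    · exact ⟨Sum.inl ⟨e, fun j => le_trans (e.monotone (Fin.le_last j)) h⟩, rfl⟩
    · have hl : (e (Fin.last k) : ℕ) = N + 1 := le_antisymm (he _) (by omega)
      have hi : ∀ j, (initEmb e j : ℕ) ≤ N := fun j => by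
        have : (e j.castSucc : ℕ) < e (Fin.last k) := e.strictMono (Fin.castSucc_lt_last j)
        rw [initEmb_apply]
        omega
      refine ⟨Sum.inr ⟨initEmb e, hi⟩, Subtype.ext
        (snocEmb_initEmb e _ (fun j => lt_succPNat_of_le (hi j)) ?_)⟩
      · rw [← PNat.coe_inj, hl]
        rfl

lemma boundedSum_succ {k : ℕ} (a : Fin (k + 1) → ℕ) (N : ℕ) :
    boundedSum a (N + 1) = boundedSum a N +
      MvPolynomial.monomial (Finsupp.single N.succPNat (a (Fin.last k))) 1 *
        boundedSum (Fin.init a) N := by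
  rw [boundedSum, ← (Equiv.ofBijective _ (boundedSplit_bijective k N)).sum_comp,
    Fintype.sum_sum_type, boundedSum, boundedSum, Finset.mul_sum]
  congr 1
  refine Finset.sum_congr rfl fun e _ => ?_
  rw [MvPolynomial.monomial_mul, one_mul]
  congr 2
  simp only [Equiv.ofBijective_apply, boundedSplit, Sum.elim_inr]
  rw [expVec_succ, initEmb_snocEmb, snocEmb_last, add_comm]

lemma boundedSum_zero_right {k : ℕ} (a : Fin (k + 1) → ℕ) : boundedSum a 0 = 0 := by
  have : IsEmpty (BoundedEmb (k + 1) 0) := ⟨fun e => by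
    have h1 := e.2 0
    have h2 := (e.1 0).pos
    omega⟩
  simp [boundedSum]

lemma boundedSum_zero_left (a : Fin 0 → ℕ) (N : ℕ) : boundedSum a N = 1 := by
  have hu : Unique (BoundedEmb 0 N) :=
    ⟨⟨⟨⟨⟨Fin.elim0, fun i => i.elim0⟩, fun {i} => i.elim0⟩, fun j => j.elim0⟩⟩,
      fun e => Subtype.ext (RelEmbedding.ext fun j => j.elim0)⟩
  rw [boundedSum, Fintype.sum_subsingleton _ hu.default]
  simp [expVec]

lemma coeff_boundedSum {k : ℕ} (a : Fin k → ℕ) (N : ℕ) (m : ℕ+ →₀ ℕ)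
    (h : ∀ e : Idx a m, ∀ j, (e.1 j : ℕ) ≤ N) :
    MvPolynomial.coeff m (boundedSum a N) = Nat.card (Idx a m) := by
  classical
  rw [boundedSum, MvPolynomial.coeff_sum]
  simp only [MvPolynomial.coeff_monomial]
  rw [Finset.sum_boole, Nat.cast_id, ← Fintype.card_subtype, ← Nat.card_eq_fintype_card]
  exact Nat.card_congr (Equiv.subtypeSubtypeEquivSubtype (fun {e} he => h ⟨e, he⟩))

lemma coeff_boundedSum_eq_zero {k : ℕ} (a : Fin (k + 1) → ℕ) (ha : 0 < a (Fin.last k)) (N : ℕ)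
    (m : ℕ+ →₀ ℕ) (h : N < maxIdx m) : MvPolynomial.coeff m (boundedSum a N) = 0 := by
  classical
  rw [boundedSum, MvPolynomial.coeff_sum]
  refine Finset.sum_eq_zero fun e _ => ?_
  rw [MvPolynomial.coeff_monomial, if_neg]
  intro he
  have h1 := Idx.apply_last ha (⟨e.1, he⟩ : Idx a m)
  have h2 := e.2 (Fin.last k)
  simp only at h1
  omega

/-- The entries of the reverse of a list. -/
def revGet : (r : List ℕ) → Fin r.length → ℕ
  | [] => Fin.elim0
  | a :: r => Fin.snoc (α := fun _ => ℕ) (revGet r) a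

/-- The lists obtained by inserting a zero. -/
def insertions : List ℕ → List (List ℕ)
  | [] => [[0]]
  | a :: r => (0 :: a :: r) :: (insertions r).map (a :: ·)

/-- The monomial quasisymmetric polynomial of the reverse of a list. -/
noncomputable abbrev revSum (r : List ℕ) (N : ℕ) : MvPolynomial ℕ+ ℕ := boundedSum (revGet r) N

lemma revSum_nil (N : ℕ) : revSum [] N = 1 := boundedSum_zero_left _ N

lemma revSum_cons_zero (a : ℕ) (r : List ℕ) : revSum (a :: r) 0 = 0 := boundedSum_zero_right _

lemma revSum_cons_succ (a : ℕ) (r : List ℕ) (N : ℕ) : revSum (a :: r) (N + 1) =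
    revSum (a :: r) N +
      MvPolynomial.monomial (Finsupp.single N.succPNat a) 1 * revSum r N := by
  have h := boundedSum_succ (revGet (a :: r)) N
  have h1 : revGet (a :: r) (Fin.last r.length) = a := Fin.snoc_last (α := fun _ => ℕ) _ _
  have h2 : Fin.init (revGet (a :: r)) = revGet r := Fin.init_snoc (α := fun _ => ℕ) _ _
  rw [h1, h2] at h
  exact h

/-- The quasi-shuffle product with `x_1^0 + ⋯ + x_N^0`. -/
lemma natCast_mul_revSum (r : List ℕ) : ∀ N : ℕ, (N : MvPolynomial ℕ+ ℕ) * revSum r N =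
    (r.length : MvPolynomial ℕ+ ℕ) * revSum r N +
      ((insertions r).map fun r' => revSum r' N).sum := by
  induction r with
  | nil =>
    intro N
    simp only [insertions, List.map_cons, List.map_nil, List.sum_cons, List.sum_nil, revSum_nil,
      List.length_nil, Nat.cast_zero, zero_add, add_zero, mul_one]
    induction N with
    | zero => rw [revSum_cons_zero, Nat.cast_zero]
    | succ N ih => rw [revSum_cons_succ, ← ih, revSum_nil]; simp
  | cons a r ihr =>
    intro N
    induction N with
    | zero =>
      simp only [insertions, List.map_cons, List.map_map, List.sum_cons, revSum_cons_zero,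
        Nat.cast_zero, mul_zero, zero_add]
      rw [eq_comm, List.sum_eq_zero]
      intro x hx
      obtain ⟨r', -, rfl⟩ := List.mem_map.mp hx
      exact revSum_cons_zero _ _
    | succ N ihN =>
      simp only [insertions, List.map_cons, List.map_map, List.sum_cons] at ihN ⊢
      have h1 : ((insertions r).map ((fun r' => revSum r' (N + 1)) ∘ fun x => a :: x)).sum =
          ((insertions r).map ((fun r' => revSum r' N) ∘ fun x => a :: x)).sum +
          MvPolynomial.monomial (Finsupp.single N.succPNat a) 1 *
            ((insertions r).map fun r' => revSum r' N).sum := by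
        rw [← List.sum_map_mul_left, ← List.sum_map_add]
        congr 1
        refine List.map_congr_left fun r' _ => ?_
        exact revSum_cons_succ a r' N
      rw [h1, revSum_cons_succ, revSum_cons_succ 0, Finsupp.single_zero,
        ← MvPolynomial.C_apply, MvPolynomial.C_1, one_mul]
      have h2 := ihr N
      push_cast [List.length_cons] at ihN ⊢
      set M := MvPolynomial.monomial (Finsupp.single N.succPNat a) (1 : ℕ)
      -- `ihN` treats `N * revSum (a :: r) N` and `ihr` treats `N * revSum r N`. The surplus `revSum
      -- (a :: r) N` comes from the inserted zero taking the index `N + 1`, and `M * revSum r N`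
      -- accounts for the extra entry `a` in the length.
      calc ((N : MvPolynomial ℕ+ ℕ) + 1) * (revSum (a :: r) N + M * revSum r N)
          = N * revSum (a :: r) N + revSum (a :: r) N + M * (N * revSum r N) +
            M * revSum r N := by ring
        _ = _ := by rw [ihN, h2]; ring

end BoundedSums

/-! ### Counting index sequences. -/

section IndexCount

lemma indexCount_eq_of_get {α : WeakComp} {k : ℕ} {a : Fin k → ℕ} (hk : α.length = k)
    (h : ∀ j : Fin k, α.get (j.cast hk.symm) = a j) (m : ℕ+ →₀ ℕ) :
    indexCount α m = Nat.card (Idx a m) := by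
  subst hk
  obtain rfl : a = α.get := funext fun j => (h j).symm
  rfl

lemma get_reverse_cast (r : List ℕ) : ∀ j : Fin r.length,
    r.reverse.get (j.cast List.length_reverse.symm) = revGet r j := by
  induction r with
  | nil => exact fun j => j.elim0
  | cons a r ih =>
    intro j
    have hj : ∀ j : Fin (r.length + 1), (a :: r).reverse.get (j.cast (by simp)) =
        (Fin.snoc (α := fun _ => ℕ) (revGet r) a : Fin (r.length + 1) → ℕ) j := by
      intro j
      induction j using Fin.lastCases with
      | last => rw [Fin.snoc_last (α := fun _ => ℕ)]; simp
      | cast j =>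
        rw [Fin.snoc_castSucc (α := fun _ => ℕ), ← ih j]
        simp [List.getElem_append_left]
    exact hj j

lemma indexCount_reverse (r : List ℕ) (m : ℕ+ →₀ ℕ) :
    indexCount r.reverse m = Nat.card (Idx (revGet r) m) :=
  indexCount_eq_of_get List.length_reverse (get_reverse_cast r) m

/-- The last index is forced to be `N + 1`; the remaining ones range freely up to `N`. -/
lemma indexCount_reverse_cons {a : ℕ} (ha : 0 < a) (r : List ℕ) {m : ℕ+ →₀ ℕ} {N : ℕ}
    (hN : maxIdx m = N + 1) : indexCount (a :: r).reverse m =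
      MvPolynomial.coeff m (MvPolynomial.monomial (Finsupp.single N.succPNat a) 1 * revSum r N) := by
  have hl : 0 < revGet (a :: r) (Fin.last r.length) := by
    have : revGet (a :: r) (Fin.last r.length) = a := Fin.snoc_last (α := fun _ => ℕ) _ _
    rwa [this]
  have h1 := coeff_boundedSum (revGet (a :: r)) (N + 1) m fun e j => by
    rw [← hN, ← Idx.apply_last hl e]
    exact e.1.monotone (Fin.le_last j)
  have h2 := revSum_cons_succ a r N
  have h3 : MvPolynomial.coeff m (revSum (a :: r) N) = 0 :=
    coeff_boundedSum_eq_zero (revGet (a :: r)) hl N m (by omega)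
  rw [indexCount_reverse, ← h1]
  change MvPolynomial.coeff m (revSum (a :: r) (N + 1)) = _
  rw [h2, MvPolynomial.coeff_add, h3, zero_add]

lemma indexCount_reverse_cons_eq_zero {a : ℕ} (ha : 0 < a) (r : List ℕ) {m : ℕ+ →₀ ℕ}
    (hm : maxIdx m = 0) : indexCount (a :: r).reverse m = 0 := by
  have hl : 0 < revGet (a :: r) (Fin.last r.length) := by
    have : revGet (a :: r) (Fin.last r.length) = a := Fin.snoc_last (α := fun _ => ℕ) _ _
    rwa [this]
  rw [indexCount_reverse]
  have : IsEmpty (Idx (revGet (a :: r)) m) := ⟨fun e => by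
    have h1 := Idx.apply_last hl e
    rw [hm] at h1
    exact (e.1 (Fin.last r.length)).pos.ne' h1⟩
  exact Nat.card_of_isEmpty

/-- With `maxIdx m = N + 1`, the quasi-shuffle identity for `N` applies to the entries before the
last; the remaining 1 turns `r.length` into `r.length + 1`. Zeros are inserted only before `a`, so
all terms stay left weak. -/
lemma maxIdx_mul_indexCount {a : ℕ} (ha : 0 < a) (r : List ℕ) (m : ℕ+ →₀ ℕ) :
    maxIdx m * indexCount (a :: r).reverse m = (r.length + 1) * indexCount (a :: r).reverse m +
      ((insertions r).map fun r' => indexCount (a :: r').reverse m).sum := by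
  rcases Nat.eq_zero_or_eq_succ_pred (maxIdx m) with h0 | h1
  · simp only [indexCount_reverse_cons_eq_zero ha _ h0]
    simp
  · simp only [indexCount_reverse_cons ha _ h1]
    set N := (maxIdx m).pred
    have h := congrArg (fun p => MvPolynomial.coeff m
      (MvPolynomial.monomial (Finsupp.single N.succPNat a) 1 * p)) (natCast_mul_revSum r N)
    simp only [mul_add, MvPolynomial.coeff_add] at h
    have hc : ∀ (n : ℕ) (p q : MvPolynomial ℕ+ ℕ), MvPolynomial.coeff m (p * ((n : MvPolynomial ℕ+ ℕ) * q)) =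
        n * MvPolynomial.coeff m (p * q) := fun n p q => by
      rw [← MvPolynomial.coeff_C_mul, mul_left_comm]
      rfl
    rw [hc, hc, ← List.sum_map_mul_left] at h
    have hs : ∀ l : List (List ℕ), MvPolynomial.coeff m (l.map fun r' =>
        MvPolynomial.monomial (Finsupp.single N.succPNat a) 1 * revSum r' N).sum =
        (l.map fun r' => MvPolynomial.coeff m
          (MvPolynomial.monomial (Finsupp.single N.succPNat a) 1 * revSum r' N)).sum := by
      intro l
      induction l with
      | nil => simp
      | cons r' l ih => rw [List.map_cons, List.sum_cons, MvPolynomial.coeff_add, ih]; simp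
    rw [hs] at h
    rw [h1, Nat.succ_eq_add_one, add_mul, h]
    ring

/-- The sequence `1, 2, …, k`. -/
def stdEmb (k : ℕ) : Fin k ↪o ℕ+ :=
  OrderEmbedding.ofStrictMono (fun j => (j : ℕ).succPNat) fun _ _ h => Nat.succ_lt_succ h

lemma stdEmb_apply (k : ℕ) (j : Fin k) : (stdEmb k j : ℕ) = j + 1 := rfl

/-- The exponent vector `x_1^{α_1} ⋯ x_k^{α_k}`. -/
noncomputable def packedExp (α : WeakComp) : ℕ+ →₀ ℕ := expVec α.get (stdEmb α.length)

lemma maxIdx_packedExp {α : WeakComp} (hα : IsLeftWeak α) : maxIdx (packedExp α) = α.length := by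
  have key : ∀ {k : ℕ} (a : Fin k → ℕ) (_ : ∀ h : 0 < k, 0 < a ⟨k - 1, by omega⟩),
      maxIdx (expVec a (stdEmb k)) = k := by
    intro k a ha
    cases k with
    | zero => simp [expVec, maxIdx]
    | succ k => rw [maxIdx_expVec a (ha k.succ_pos), stdEmb_apply, Fin.val_last]
  exact key _ (isLeftWeak_iff_get.mp hα)

lemma add_le_embedding {k : ℕ} (e : Fin k ↪o ℕ+) (d : ℕ) :
    ∀ i j : Fin k, (j : ℕ) = i + d → (e i : ℕ) + d ≤ e j := by
  induction d with
  | zero =>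
    intro i j h
    rw [add_zero, ← Fin.ext_iff] at h
    rw [h, add_zero]
  | succ d ih =>
    intro i j h
    have hj := j.2
    have h1 := ih i ⟨i + d, by omega⟩ rfl
    have h2 : (e ⟨i + d, by omega⟩ : ℕ) < e j := e.strictMono (Fin.lt_def.mpr (by simp; omega))
    omega

lemma succ_le_embedding {k : ℕ} (e : Fin k ↪o ℕ+) (j : Fin k) : (j : ℕ) + 1 ≤ e j := by
  have hj := j.2
  have h1 := add_le_embedding e j ⟨0, by omega⟩ j (by simp)
  have h2 := (e ⟨0, by omega⟩).pos
  omega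

/-- An increasing sequence of `k` positive integers ends at `k` or later, and ends at `k` only if it
is `1, …, k`. For nonempty `γ` its end is `maxIdx m`. -/
lemma length_le_of_idx {γ : WeakComp} (hγ : IsLeftWeak γ) {m : ℕ+ →₀ ℕ} (e : Idx γ.get m) :
    γ.length ≤ maxIdx m ∧ (γ.length = maxIdx m → e.1 = stdEmb γ.length) := by
  have key : ∀ {k : ℕ} (a : Fin k → ℕ) (_ : ∀ h : 0 < k, 0 < a ⟨k - 1, by omega⟩) (e : Idx a m),
      k ≤ maxIdx m ∧ (k = maxIdx m → e.1 = stdEmb k) := by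
    intro k a ha e
    cases k with
    | zero => exact ⟨Nat.zero_le _, fun _ => RelEmbedding.ext fun j => j.elim0⟩
    | succ k =>
      have hl : (e.1 (Fin.last k) : ℕ) = maxIdx m := e.apply_last (ha k.succ_pos)
      refine ⟨?_, fun hk => RelEmbedding.ext fun j => ?_⟩
      · have := succ_le_embedding e.1 (Fin.last k)
        rw [hl, Fin.val_last] at this
        exact this
      · have h1 := succ_le_embedding e.1 j
        have h2 := j.2
        have h3 := add_le_embedding e.1 (k - j) j (Fin.last k) (by simp; omega)
        rw [hl, ← hk] at h3
        rw [← PNat.coe_inj, stdEmb_apply]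
        omega
  exact key _ (isLeftWeak_iff_get.mp hγ) e

lemma indexCount_packedExp_self {α : WeakComp} (hα : IsLeftWeak α) :
    indexCount α (packedExp α) = 1 := by
  rw [indexCount, Nat.card_eq_one_iff_unique]
  refine ⟨⟨fun e e' => Subtype.ext ?_⟩, ⟨⟨stdEmb α.length, rfl⟩⟩⟩
  rw [(length_le_of_idx hα e).2 (maxIdx_packedExp hα).symm,
    (length_le_of_idx hα e').2 (maxIdx_packedExp hα).symm]

/-- Triangularity: a contributing `γ` has length at most `α.length`, hence equal length, hence uses
the indices `1, …, k` and has the entries of `α`. -/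
lemma indexCount_packedExp_eq_zero {α γ : WeakComp} (hα : IsLeftWeak α) (hγ : IsLeftWeak γ)
    (hlen : α.length ≤ γ.length) (hne : γ ≠ α) : indexCount γ (packedExp α) = 0 := by
  have : IsEmpty (Idx γ.get (packedExp α)) := ⟨fun e => hne ?_⟩
  · exact Nat.card_of_isEmpty
  have h := length_le_of_idx hγ e
  rw [maxIdx_packedExp hα] at h
  have hl : γ.length = α.length := le_antisymm h.1 hlen
  have he := h.2 hl
  refine List.ext_get hl fun n h1 h2 => ?_
  have h3 := expVec_apply γ.get e.1 ⟨n, h1⟩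
  have h4 := expVec_apply α.get (stdEmb α.length) ⟨n, h2⟩
  rw [e.2, he] at h3
  rw [← h3, ← h4]
  rfl

end IndexCount
-- The span of the left weak functions is stable under polynomials in the largest index.
section Module

variable {k : Type*} [CommRing k]

lemma kappa_smul (m : ℕ+ →₀ ℕ) (c : k) (f : PolySeries k) : kappa m (c • f) = c • kappa m f := by
  ext s
  rw [coeff_kappa, Polynomial.coeff_smul, Polynomial.coeff_smul, coeff_kappa, map_smul]

lemma kappa_C (m : ℕ+ →₀ ℕ) (f : MvPowerSeries ℕ+ k) :
    kappa m (Polynomial.C f) = Polynomial.C (MvPowerSeries.coeff m f) := by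
  ext s
  rw [coeff_kappa, Polynomial.coeff_C, Polynomial.coeff_C]
  split_ifs <;> simp

lemma kappa_constPoly_mul_C (m : ℕ+ →₀ ℕ) (p : k[X]) (f : MvPowerSeries ℕ+ k) :
    kappa m (constPoly p * Polynomial.C f) = p * Polynomial.C (MvPowerSeries.coeff m f) := by
  rw [kappa_constPoly_mul, kappa_C]

/-- The product of a polynomial in `t` and a power series, as a bilinear map. -/
noncomputable def polyMul : k[X] →ₗ[k] MvPowerSeries ℕ+ k →ₗ[k] PolySeries k :=
  LinearMap.mk₂ k (fun p f => constPoly p * Polynomial.C f)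
    (fun p q f => by rw [map_add, add_mul])
    (fun c p f => polySeries_ext fun m => by
      rw [kappa_smul, kappa_constPoly_mul_C, kappa_constPoly_mul_C, smul_mul_assoc])
    (fun p f g => by rw [map_add, mul_add])
    (fun c p f => polySeries_ext fun m => by
      rw [kappa_smul, kappa_constPoly_mul_C, kappa_constPoly_mul_C, map_smul, smul_eq_mul,
        map_mul, Polynomial.smul_eq_C_mul]
      ring)

lemma polyMul_apply (p : k[X]) (f : MvPowerSeries ℕ+ k) :
    polyMul p f = constPoly p * Polynomial.C f := rfl

lemma kappa_polyMul (m : ℕ+ →₀ ℕ) (p : k[X]) (f : MvPowerSeries ℕ+ k) :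
    kappa m (polyMul p f) = p * Polynomial.C (MvPowerSeries.coeff m f) :=
  kappa_constPoly_mul_C m p f

/-- The operator multiplying the coefficient of `x^m` by the value of `q` at the largest index of
a variable in `x^m`. -/
def maxIdxOp (q : k[X]) : MvPowerSeries ℕ+ k →ₗ[k] MvPowerSeries ℕ+ k where
  toFun f m := q.eval (maxIdx m : k) * MvPowerSeries.coeff m f
  map_add' f g := by
    ext m
    exact mul_add _ _ _
  map_smul' c f := by
    ext m
    exact mul_left_comm _ _ _

lemma coeff_maxIdxOp (q : k[X]) (f : MvPowerSeries ℕ+ k) (m : ℕ+ →₀ ℕ) :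
    MvPowerSeries.coeff m (maxIdxOp q f) =
      q.eval (maxIdx m : k) * MvPowerSeries.coeff m f := rfl

variable (k) in
/-- The quasisymmetric function of a left weak composition. -/
noncomputable def countSeries (α : WeakComp) : MvPowerSeries ℕ+ k := fun m => (indexCount α m : k)

lemma coeff_countSeries (α : WeakComp) (m : ℕ+ →₀ ℕ) :
    MvPowerSeries.coeff m (countSeries k α) = (indexCount α m : k) := rfl

variable (k) in
/-- The span of the quasisymmetric functions of left weak compositions. -/
noncomputable def countSpan : Submodule k (MvPowerSeries ℕ+ k) :=
  Submodule.span k (Set.range fun α : LeftWeakComp => countSeries k α.1)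

lemma countSeries_mem {α : WeakComp} (hα : IsLeftWeak α) : countSeries k α ∈ countSpan k :=
  Submodule.subset_span ⟨⟨α, hα⟩, rfl⟩

lemma isLeftWeak_cases {α : WeakComp} (hα : IsLeftWeak α) :
    α = [] ∨ ∃ v a, 0 < a ∧ α = v ++ [a] := by
  rcases List.eq_nil_or_concat α with h | ⟨v, a, rfl⟩
  · exact Or.inl h
  · exact Or.inr ⟨v, a, by simpa using hα (by simp), by simp⟩

lemma isLeftWeak_reverse_cons {a : ℕ} (ha : 0 < a) (r : List ℕ) :
    IsLeftWeak (a :: r).reverse := by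
  intro h
  simpa using ha

lemma isLeftWeak_nil : IsLeftWeak [] := fun h => absurd rfl h

lemma indexCount_nil (m : ℕ+ →₀ ℕ) : indexCount [] m = if m = 0 then 1 else 0 := by
  -- The count is the constant term in `z` of `phi [] = 1`; the direction `1` is arbitrary, the list
  -- being empty.
  have h := coeff_zero_lkappa_phi isLeftWeak_nil 1 m
  change (lkappa m (phi [])).coeff 0 = _ at h
  rw [phi_nil, lkappa_one] at h
  have h2 : ((if m = 0 then 1 else 0 : ℕ) : ℚ[X]) = (indexCount [] m : ℚ[X]) := by
    rw [← h]
    split_ifs <;> simp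
  exact_mod_cast h2.symm

lemma maxIdx_zero : maxIdx 0 = 0 := by simp [maxIdx]

lemma maxIdxOp_X_countSeries {a : ℕ} (ha : 0 < a) (r : List ℕ) :
    maxIdxOp Polynomial.X (countSeries k (a :: r).reverse) =
      ((r.length + 1 : ℕ) : k) • countSeries k (a :: r).reverse +
        ((insertions r).map fun r' => countSeries k (a :: r').reverse).sum := by
  ext m
  have h := congrArg (fun n : ℕ => (n : k)) (maxIdx_mul_indexCount ha r m)
  rw [coeff_maxIdxOp, map_add, map_smul, map_list_sum, List.map_map, Polynomial.eval_X,
    coeff_countSeries]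
  simp only [Nat.cast_add, Nat.cast_mul, Nat.cast_list_sum, List.map_map] at h
  rw [h]
  simp only [smul_eq_mul, Nat.cast_add, Nat.cast_one]
  rfl

lemma maxIdxOp_X_mem {f : MvPowerSeries ℕ+ k} (hf : f ∈ countSpan k) :
    maxIdxOp Polynomial.X f ∈ countSpan k := by
  induction hf using Submodule.span_induction with
  | zero => rw [map_zero]; exact zero_mem _
  | add f g _ _ hf hg => rw [map_add]; exact add_mem hf hg
  | smul c f _ hf => rw [map_smul]; exact Submodule.smul_mem _ c hf
  | mem f hf =>
    obtain ⟨⟨α, hα⟩, rfl⟩ := hf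
    rcases isLeftWeak_cases hα with rfl | ⟨v, a, ha, rfl⟩
    · have h0 : maxIdxOp Polynomial.X (countSeries k []) = 0 := by
        ext m
        rw [coeff_maxIdxOp, coeff_countSeries, indexCount_nil]
        by_cases hm : m = 0
        · simp [hm, maxIdx_zero]
        · simp [hm]
      simp only [h0]
      exact zero_mem _
    · obtain ⟨r, rfl⟩ : ∃ r : List ℕ, v = r.reverse := ⟨v.reverse, v.reverse_reverse.symm⟩
      simp only [← List.reverse_cons]
      rw [maxIdxOp_X_countSeries ha]
      refine add_mem (Submodule.smul_mem _ _ (countSeries_mem (isLeftWeak_reverse_cons ha r)))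
        (list_sum_mem fun x hx => ?_)
      obtain ⟨r', -, rfl⟩ := List.mem_map.mp hx
      exact countSeries_mem (isLeftWeak_reverse_cons ha r')

lemma maxIdxOp_mem (q : k[X]) {f : MvPowerSeries ℕ+ k} (hf : f ∈ countSpan k) :
    maxIdxOp q f ∈ countSpan k := by
  induction q using Polynomial.induction_on with
  | C a =>
    have : maxIdxOp (Polynomial.C a) f = a • f := by
      ext m
      rw [coeff_maxIdxOp, Polynomial.eval_C]
      rfl
    rw [this]
    exact Submodule.smul_mem _ a hf
  | add p q hp hq =>
    have : maxIdxOp (p + q) f = maxIdxOp p f + maxIdxOp q f := by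
      ext m
      rw [map_add, coeff_maxIdxOp, coeff_maxIdxOp, coeff_maxIdxOp, Polynomial.eval_add, add_mul]
    rw [this]
    exact add_mem hp hq
  | monomial n a h =>
    have : maxIdxOp (Polynomial.C a * Polynomial.X ^ (n + 1)) f =
        maxIdxOp Polynomial.X (maxIdxOp (Polynomial.C a * Polynomial.X ^ n) f) := by
      ext m
      rw [coeff_maxIdxOp, coeff_maxIdxOp, coeff_maxIdxOp, pow_succ, ← mul_assoc,
        Polynomial.eval_mul, mul_comm (Polynomial.eval _ (_ * _)), mul_assoc]
    rw [this]
    exact maxIdxOp_X_mem h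

end Module

/-! ### Powers of a linear polynomial, and independence over the polynomials in `t`. -/

section LinearPolynomial

variable {k : Type*} [CommRing k] {q : k[X]}

lemma eq_linear (hd : q.natDegree ≤ 1) :
    q = Polynomial.C (q.coeff 1) * Polynomial.X + Polynomial.C (q.coeff 0) :=
  Polynomial.eq_X_add_C_of_natDegree_le_one hd

/-- The inverse substitutes `p`, the compositional inverse of `q`. This carries the basis of
monomials to the powers of `q`. -/
lemma bijective_aeval_linear (hd : q.natDegree ≤ 1) (hu : IsUnit (q.coeff 1)) :
    Function.Bijective (Polynomial.aeval (R := k) q) := by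
  obtain ⟨u, hu⟩ := hu
  let p : k[X] := Polynomial.C (↑u⁻¹ : k) * (Polynomial.X - Polynomial.C (q.coeff 0))
  have hq : q = Polynomial.C (u : k) * Polynomial.X + Polynomial.C (q.coeff 0) := by
    rw [hu]
    exact eq_linear hd
  have huu : Polynomial.C (u : k) * Polynomial.C (↑u⁻¹ : k) = 1 := by
    rw [← Polynomial.C_mul, Units.mul_inv, Polynomial.C_1]
  have h1 : (Polynomial.aeval (R := k) p).comp (Polynomial.aeval q) = AlgHom.id k k[X] := by
    refine Polynomial.algHom_ext ?_
    rw [AlgHom.comp_apply, Polynomial.aeval_X, hq]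
    simp only [map_add, map_mul, Polynomial.aeval_X, Polynomial.aeval_C,
      Polynomial.algebraMap_eq, AlgHom.id_apply, p]
    linear_combination (Polynomial.X - Polynomial.C (q.coeff 0)) * huu
  have h2 : (Polynomial.aeval (R := k) q).comp (Polynomial.aeval p) = AlgHom.id k k[X] := by
    refine Polynomial.algHom_ext ?_
    rw [AlgHom.comp_apply, Polynomial.aeval_X]
    simp only [map_sub, map_mul, Polynomial.aeval_X, Polynomial.aeval_C,
      Polynomial.algebraMap_eq, AlgHom.id_apply, p]
    linear_combination Polynomial.C (↑u⁻¹ : k) * hq + Polynomial.X * huu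
  exact ⟨Function.LeftInverse.injective fun x => DFunLike.congr_fun h1 x,
    Function.RightInverse.surjective fun x => DFunLike.congr_fun h2 x⟩

lemma linearIndependent_pow_linear (hd : q.natDegree ≤ 1) (hu : IsUnit (q.coeff 1)) :
    LinearIndependent k (fun n : ℕ => q ^ n) := by
  have h := (Polynomial.basisMonomials k).linearIndependent.map'
    (Polynomial.aeval (R := k) q).toLinearMap
    (LinearMap.ker_eq_bot.mpr (bijective_aeval_linear hd hu).1)
  have hfun : ((Polynomial.aeval (R := k) q).toLinearMap ∘ Polynomial.basisMonomials k) =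
      fun n : ℕ => q ^ n := funext fun n => by simp [Polynomial.aeval_monomial]
  rwa [hfun] at h

lemma mem_span_pow_linear (hd : q.natDegree ≤ 1) (hu : IsUnit (q.coeff 1)) (p : k[X]) :
    p ∈ Submodule.span k (Set.range fun n : ℕ => q ^ n) := by
  obtain ⟨p, rfl⟩ := (bijective_aeval_linear hd hu).2 p
  rw [Polynomial.aeval_eq_sum_range]
  exact sum_mem fun i _ => Submodule.smul_mem _ _ (Submodule.subset_span ⟨i, rfl⟩)

/-- The linear map sending a family of polynomials `p_α` to `∑ p_α M_α`. -/
noncomputable def countCombination : (LeftWeakComp →₀ k[X]) →ₗ[k] PolySeries k :=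
  Finsupp.lsum k fun α => polyMul.flip (countSeries k α.1)

lemma kappa_countCombination (m : ℕ+ →₀ ℕ) (f : LeftWeakComp →₀ k[X]) :
    kappa m (countCombination f) = ∑ γ ∈ f.support, f γ * (indexCount γ.1 m : k[X]) := by
  rw [countCombination, Finsupp.lsum_apply, Finsupp.sum, map_sum]
  refine Finset.sum_congr rfl fun γ _ => ?_
  rw [LinearMap.flip_apply, kappa_polyMul, coeff_countSeries, map_natCast]

/-- In a nontrivial relation take a shortest composition `α` of the support. At the monomial
`packedExp α` every other term vanishes, which leaves the polynomial coefficient of `α` alone. -/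
lemma countCombination_injective :
    Function.Injective (countCombination : (LeftWeakComp →₀ k[X]) →ₗ[k] PolySeries k) := by
  rw [injective_iff_map_eq_zero]
  intro f hf
  by_contra hne
  obtain ⟨α, hα, hmin⟩ := Finset.exists_min_image f.support (fun γ => γ.1.length)
    (Finsupp.support_nonempty_iff.mpr hne)
  have h := kappa_countCombination (packedExp α.1) f
  rw [hf, map_zero, Finset.sum_eq_single α, indexCount_packedExp_self α.2, Nat.cast_one,
    mul_one] at h
  · exact Finsupp.mem_support_iff.mp hα h.symm
  · intro γ hγ hγα
    rw [indexCount_packedExp_eq_zero α.2 γ.2 (hmin γ hγ) fun h => hγα (Subtype.ext h),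
      Nat.cast_zero, mul_zero]
  · exact fun h => absurd hα h

lemma linearIndependent_polyMul (hd : q.natDegree ≤ 1) (hu : IsUnit (q.coeff 1)) :
    LinearIndependent k
      (fun i : ℕ × LeftWeakComp => polyMul (q ^ i.1) (countSeries k i.2.1)) := by
  have h1 : LinearIndependent k (fun i : Σ _ : LeftWeakComp, ℕ =>
      (Finsupp.single i.1 (q ^ i.2) : LeftWeakComp →₀ k[X])) :=
    Finsupp.linearIndependent_single (fun _ : LeftWeakComp => fun n : ℕ => q ^ n)
      fun _ => linearIndependent_pow_linear hd hu
  have h2 := (h1.map' countCombination (LinearMap.ker_eq_bot.mpr countCombination_injective)).comp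
    (fun i : ℕ × LeftWeakComp => (⟨i.2, i.1⟩ : Σ _ : LeftWeakComp, ℕ)) (by
      rintro ⟨n, α⟩ ⟨n', α'⟩ h
      simp only [Sigma.mk.injEq, heq_eq_eq] at h
      rw [h.1, h.2])
  have hfun : ((countCombination ∘ fun i : Σ _ : LeftWeakComp, ℕ =>
      (Finsupp.single i.1 (q ^ i.2) : LeftWeakComp →₀ k[X])) ∘
      fun i : ℕ × LeftWeakComp => (⟨i.2, i.1⟩ : Σ _ : LeftWeakComp, ℕ)) =
      fun i => polyMul (q ^ i.1) (countSeries k i.2.1) :=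
    funext fun i => by simp [countCombination]
  rwa [hfun] at h2

lemma polyMul_mem_span {q : k[X]} (hd : q.natDegree ≤ 1) (hu : IsUnit (q.coeff 1)) (p : k[X])
    {f : MvPowerSeries ℕ+ k} (hf : f ∈ countSpan k) : polyMul p f ∈ Submodule.span k
      (Set.range fun i : ℕ × LeftWeakComp => polyMul (q ^ i.1) (countSeries k i.2.1)) := by
  have h := Submodule.apply_mem_map₂ polyMul (mem_span_pow_linear hd hu p) hf
  rw [countSpan, Submodule.map₂_span_span] at h
  refine Submodule.span_mono ?_ h
  rintro _ ⟨_, ⟨n, rfl⟩, _, ⟨α, rfl⟩, rfl⟩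
  exact ⟨(n, α), rfl⟩

end LinearPolynomial

/-! ### Description of RenQSym and its basis. -/

section RenormalizedFunctions

variable (k : Type*) [CommRing k] [Algebra ℚ k] (δ : ℕ+)

/-- The polynomial `zeroConst` over `k`. -/
noncomputable def zeroConstMap (r : ℕ) : k[X] := (zeroConst δ r).map (algebraMap ℚ k)

lemma natDegree_zeroConstMap_le (r : ℕ) : (zeroConstMap k δ r).natDegree ≤ r :=
  Polynomial.natDegree_map_le.trans (zeroConst_degree δ r).1

lemma isUnit_coeff_zeroConstMap (r : ℕ) : IsUnit ((zeroConstMap k δ r).coeff r) := by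
  rw [zeroConstMap, Polynomial.coeff_map]
  exact (IsUnit.mk0 _ (zeroConst_degree δ r).2).map _

lemma kappa_renM {α : WeakComp} (hα : IsLeftWeak α) (r : ℕ) (m : ℕ+ →₀ ℕ) :
    kappa m (renM k δ (α ++ List.replicate r 0)) =
      (indexCount α m : k[X]) * Polynomial.taylor (maxIdx m : k) (zeroConstMap k δ r) := by
  have h1 : ∀ f : PolySeries ℚ, kappa m (Polynomial.map (MvPowerSeries.map (algebraMap ℚ k)) f) =
      (kappa m f).map (algebraMap ℚ k) := fun f => by
    ext s
    rw [coeff_kappa, Polynomial.coeff_map, Polynomial.coeff_map, coeff_kappa,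
      MvPowerSeries.coeff_map]
  rw [renM, h1, kappa_dirQSym δ hα, Polynomial.map_mul, Polynomial.map_natCast,
    Polynomial.map_taylor, map_natCast, zeroConstMap]

/-- Taylor expansion of `p(t + N)` in powers of `t`, with `N = maxIdx m`: the coefficient of `t^i`
is the `i`-th Hasse derivative of `p` at `N`. -/
lemma renM_append_zeros {α : WeakComp} (hα : IsLeftWeak α) (r : ℕ) :
    renM k δ (α ++ List.replicate r 0) = ∑ i ∈ Finset.range (r + 1), polyMul (Polynomial.X ^ i)
      (maxIdxOp (Polynomial.hasseDeriv i (zeroConstMap k δ r)) (countSeries k α)) := by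
  refine polySeries_ext fun m => ?_
  rw [kappa_renM k δ hα, map_sum]
  ext s
  simp only [kappa_polyMul, Polynomial.finsetSum_coeff, Polynomial.coeff_mul_C,
    Polynomial.coeff_X_pow, coeff_maxIdxOp, coeff_countSeries]
  rw [← Polynomial.C_eq_natCast, Polynomial.coeff_C_mul, Polynomial.taylor_coeff]
  simp only [ite_mul, one_mul, zero_mul, Finset.sum_ite_eq, Finset.mem_range]
  split_ifs with h
  · rw [mul_comm]
  · rw [Polynomial.hasseDeriv_eq_zero_of_lt_natDegree, Polynomial.eval_zero, mul_zero]
    have := natDegree_zeroConstMap_le k δ r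
    omega

lemma exists_eq_append_zeros (α : WeakComp) :
    ∃ γ r, IsLeftWeak γ ∧ α = γ ++ List.replicate r 0 := by
  induction α using List.reverseRecOn with
  | nil => exact ⟨[], 0, isLeftWeak_nil, rfl⟩
  | append_singleton v a ih =>
    rcases Nat.eq_zero_or_pos a with rfl | ha
    · obtain ⟨γ, r, hγ, rfl⟩ := ih
      exact ⟨γ, r + 1, hγ, by rw [List.replicate_succ', List.append_assoc]⟩
    · exact ⟨v ++ [a], 0, fun h => by simpa using ha, by simp⟩

lemma zeroConstMap_zero : zeroConstMap k δ 0 = 1 := by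
  rw [zeroConstMap, zeroConst_zero, Polynomial.map_one]

lemma renM_of_isLeftWeak {α : WeakComp} (hα : IsLeftWeak α) :
    renM k δ α = Polynomial.C (countSeries k α) := by
  refine polySeries_ext fun m => ?_
  have h := kappa_renM k δ hα 0 m
  rw [List.replicate_zero, List.append_nil, zeroConstMap_zero, Polynomial.taylor_one,
    Polynomial.C_1, mul_one] at h
  rw [h, kappa_C, coeff_countSeries, map_natCast]

lemma renM_zero : renM k δ [0] = constPoly (zeroConstMap k δ 1) := by
  refine polySeries_ext fun m => ?_
  have h := kappa_renM k δ isLeftWeak_nil 1 m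
  have h2 := kappa_constPoly_mul m (zeroConstMap k δ 1) 1
  rw [mul_one, kappa_one] at h2
  rw [h2]
  refine h.trans ?_
  rw [indexCount_nil]
  split_ifs with hm
  · simp [hm, maxIdx_zero]
  · simp

lemma renM_zero_pow_mul {α : WeakComp} (hα : IsLeftWeak α) (n : ℕ) :
    renM k δ [0] ^ n * renM k δ α = polyMul (zeroConstMap k δ 1 ^ n) (countSeries k α) := by
  rw [renM_zero, renM_of_isLeftWeak k δ hα, polyMul_apply, map_pow]

/-- In the expansion of `M_{α 0^r}` the top term is a unit times `t^r M_α`, and the lower powers of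
`t` have coefficients in `countSpan`. The induction must cover all of `countSpan` because `maxIdxOp`
leaves the generators. -/
lemma X_pow_polyMul_mem (r : ℕ) : ∀ f ∈ countSpan k,
    polyMul (Polynomial.X ^ r) f ∈ renQSym k δ := by
  induction r using Nat.strong_induction_on with
  | _ r ih =>
    intro f hf
    induction hf using Submodule.span_induction with
    | zero => rw [map_zero]; exact zero_mem _
    | add f g _ _ hf hg => rw [map_add]; exact add_mem hf hg
    | smul c f _ hf => rw [map_smul]; exact Submodule.smul_mem _ c hf
    | mem f hf =>
      obtain ⟨⟨α, hα⟩, rfl⟩ := hf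
      have h := renM_append_zeros k δ hα r
      have hmem : renM k δ (α ++ List.replicate r 0) ∈ renQSym k δ :=
        Submodule.subset_span ⟨_, rfl⟩
      have hlow : ∑ i ∈ Finset.range r, polyMul (Polynomial.X ^ i) (maxIdxOp
          (Polynomial.hasseDeriv i (zeroConstMap k δ r)) (countSeries k α)) ∈ renQSym k δ :=
        sum_mem fun i hi => ih i (Finset.mem_range.mp hi) _
          (maxIdxOp_mem _ (countSeries_mem hα))
      have htop : maxIdxOp (Polynomial.hasseDeriv r (zeroConstMap k δ r)) (countSeries k α) =
          (zeroConstMap k δ r).coeff r • countSeries k α := by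
        ext m
        have hd : (Polynomial.hasseDeriv r (zeroConstMap k δ r)).natDegree = 0 := by
          have := natDegree_zeroConstMap_le k δ r
          have := Polynomial.natDegree_hasseDeriv_le (zeroConstMap k δ r) r
          omega
        rw [coeff_maxIdxOp, Polynomial.eq_C_of_natDegree_eq_zero hd, Polynomial.eval_C,
          Polynomial.hasseDeriv_coeff]
        simp
      rw [Finset.sum_range_succ, htop, map_smul] at h
      rw [h, Submodule.add_mem_iff_right _ hlow] at hmem
      obtain ⟨u, hu⟩ := isUnit_coeff_zeroConstMap k δ r
      have := Submodule.smul_mem _ (↑u⁻¹ : k) hmem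
      rwa [smul_smul, ← hu, Units.inv_mul, one_smul] at this

lemma polyMul_mem_renQSym (p : k[X]) {f : MvPowerSeries ℕ+ k} (hf : f ∈ countSpan k) :
    polyMul p f ∈ renQSym k δ := by
  rw [p.as_sum_range_C_mul_X_pow, map_sum, LinearMap.sum_apply]
  refine sum_mem fun i _ => ?_
  rw [← Polynomial.smul_eq_C_mul, map_smul, LinearMap.smul_apply]
  exact Submodule.smul_mem _ _ (X_pow_polyMul_mem k δ i f hf)

lemma renQSym_eq_span : renQSym k δ = Submodule.span k (Set.range fun i : ℕ × LeftWeakComp =>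
    polyMul (zeroConstMap k δ 1 ^ i.1) (countSeries k i.2.1)) := by
  apply le_antisymm
  · refine Submodule.span_le.mpr ?_
    rintro _ ⟨α, rfl⟩
    obtain ⟨γ, r, hγ, rfl⟩ := exists_eq_append_zeros α
    rw [renM_append_zeros k δ hγ]
    exact sum_mem fun i _ => polyMul_mem_span (natDegree_zeroConstMap_le k δ 1)
      (isUnit_coeff_zeroConstMap k δ 1) _ (maxIdxOp_mem _ (countSeries_mem hγ))
  · refine Submodule.span_le.mpr ?_
    rintro _ ⟨i, rfl⟩
    exact polyMul_mem_renQSym k δ _ (countSeries_mem i.2.2)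

end RenormalizedFunctions
end RenQ

theorem mainTheorem7 (k : Type*) [CommRing k] [Nontrivial k] [Algebra ℚ k] (δ : ℕ+) :
    ∃ b : Module.Basis (ℕ × RenQ.LeftWeakComp) k (RenQ.renQSym k δ),
      ∀ (n : ℕ) (α : RenQ.LeftWeakComp),
        (b (n, α) : RenQ.PolySeries k) = RenQ.renM k δ [0] ^ n * RenQ.renM k δ α.1 := by
  rw [RenQ.renQSym_eq_span k δ]
  refine ⟨Module.Basis.span (RenQ.linearIndependent_polyMul
    (RenQ.natDegree_zeroConstMap_le k δ 1) (RenQ.isUnit_coeff_zeroConstMap k δ 1)), fun n α => ?_⟩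
  rw [Module.Basis.span_apply, RenQ.renM_zero_pow_mul k δ α.2]
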